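/- Let $d\ge 1$, $\lambda_1,\dots,\lambda_d\in\mathbf C$ and $\gamma(s)=\prod_{k=1}^d\Gamma\left(\frac{s+\lambda_k}{2}\right)$. Let $c>\max_k(-\operatorname{Re}\lambda_k)$ and let $$\phi(t)=\frac1{2\pi i}\int_{c-i\infty}^{c+i\infty}\gamma(z)t^{-z}\,dz\qquad(t>0)$$ be the inverse Mellin transform of $\gamma$, and $G_s(t)=t^{-s}\int_t^\infty\phi(x)x^s\frac{dx}{x}$ for $s\in\mathbf C$, $t>0$. Call $\lambda_i,\lambda_j$ equivalent if $\lambda_i-\lambda_j\in2\mathbf Z$; let $\Lambda_1,\dots,\Lambda_N$ be the equivalence classes, $l_j=|\Lambda_j|$ (counted with multiplicity), and $m_j=2-\lambda$ with $\lambda\in\Lambda_j$ the element of smallest real part. Let $c_j^{(0)}(X)$ be the Taylor polynomial of $\gamma(X+m_j)$ at $X=0$ modulo $X^{l_j}$, and for $n\ge1$ define the Laurent series $$c_j^{(n)}(X)=c_j^{(n-1)}(X)\Big/\prod_{k=1}^d\left(\frac{X+\lambda_k+m_j}{2}-n\right);$$ let $c_{j,i}^{(n)}$ be the coefficient of $X^{-i}$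 in $c_j^{(n)}(X)$. For $\alpha\in\mathbf C$ and integers $j,k\ge 0$ put $$L_{\alpha,j,k}(x)=k!\sum_{i=0}^{j-1}\binom{i-j}{k}\frac{\alpha^{i-j-k}}{i!}(-x)^i\quad(\alpha\ne0),\qquad L_{0,j,k}(x)=0,$$ and for $s\in\mathbf C$, $k\ge0$, $n\ge 1$, $1\le j\le N$ and $t>0$ put $$S^{(n)}_{j,k,s}(x)=\sum_{i=1}^{l_j}c^{(n)}_{j,i}L_{2n+s-m_j,i,k}(x),\qquad \tilde G_{s,k}(t)=\sum_{j=1}^N t^{-m_j}\sum_{n=1}^\infty S^{(n)}_{j,k,s}(\ln t)\,t^{2n}.$$ Then the following hold. (a) $\int_0^\infty\phi(t)t^z\frac{dt}t$ converges absolutely and equals $\gamma(z)$ whenever $\operatorname{Re}z>\max_k(-\operatorname{Re}\lambda_k)$. (b) For every $t>0$, the integral defining $G_s(t)$ converges absolutely for all $s\in\mathbf C$, and $s\mapsto G_s(t)$ is entire. (c) For all $t>0$, $s\in\mathbf C$, $k\ge0$ and each $j$, the series $\sum_{n\ge1}S^{(n)}_{j,k,s}(\ln t)t^{2n}$ converges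 absolutely and exponentially fast: for every $r>0$ the difference between its sum and its $M$-th partial sum is $O(r^M)$ as $M\to\infty$. (d) For all $t>0$, $s\in\mathbf C$ and $k\ge0$, $$\frac{\partial^k}{\partial s^k}G_s(t)=\left(\frac{\partial^k}{\partial S^k}\frac{\gamma(S)}{t^S}\right)^*_{S=s}-\tilde G_{s,k}(t),$$ where $f(S)^*_{S=s}$ denotes the constant term $a_0$ of the Laurent expansion $\sum_n a_n(S-s)^n$ of $f$ at $S=s$ (which exists for the function at hand). -/

import Mathlib

open Filter Topology Asymptotics MeasureTheory Set

namespace GammaFactor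

noncomputable section

/-- The Gamma factor `γ(s) = ∏ₖ Γ((s + λₖ)/2)`. -/
def gammaFactor {d : ℕ} (lam : Fin d → ℂ) (s : ℂ) : ℂ :=
  ∏ k, Complex.Gamma ((s + lam k) / 2)

/-- The inverse Mellin transform
`φ(t) = (1/2πi) ∫_{Re z = c} γ(z) t^{-z} dz` of the Gamma factor, taken along `Re z = c`. -/
def phi {d : ℕ} (lam : Fin d → ℂ) (c : ℝ) (t : ℝ) : ℂ :=
  mellinInv c (gammaFactor lam) t

/-- `G_s(t) = t^{-s} ∫_t^∞ φ(x) x^s dx/x`. -/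
def incompleteMellin {d : ℕ} (lam : Fin d → ℂ) (c : ℝ) (s : ℂ) (t : ℝ) : ℂ :=
  (t : ℂ) ^ (-s) * ∫ x in Ioi t, phi lam c x * (x : ℂ) ^ (s - 1)

/-- `λᵢ` and `λⱼ` are equivalent when `λᵢ - λⱼ` is an even integer. -/
def hodgeSetoid {d : ℕ} (lam : Fin d → ℂ) : Setoid (Fin d) where
  r i j := ∃ n : ℤ, lam i - lam j = 2 * (n : ℂ)
  iseqv := by
    refine ⟨fun i => ⟨0, by simp⟩, ?_, ?_⟩
    · rintro i j ⟨n, hn⟩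
      exact ⟨-n, by push_cast; linear_combination -hn⟩
    · rintro i j k ⟨n, hn⟩ ⟨m, hm⟩
      exact ⟨n + m, by push_cast; linear_combination hn + hm⟩

/-- The set of equivalence classes `Λ₁, …, Λ_N` (classes of indices, so that repeated
values of `λ` are counted with multiplicity). -/
abbrev HodgeClass {d : ℕ} (lam : Fin d → ℂ) : Type := Quotient (hodgeSetoid lam)

instance {d : ℕ} (lam : Fin d → ℂ) : Fintype (HodgeClass lam) :=
  Fintype.ofFinite _

/-- The size `l_q` of an equivalence class. -/
def classSize {d : ℕ} (lam : Fin d → ℂ) (q : HodgeClass lam) : ℕ :=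
  Nat.card {i : Fin d // (Quotient.mk (hodgeSetoid lam) i : HodgeClass lam) = q}

theorem exists_smallest {d : ℕ} (lam : Fin d → ℂ) (q : HodgeClass lam) :
    ∃ i : Fin d, (Quotient.mk (hodgeSetoid lam) i : HodgeClass lam) = q ∧
      ∀ i' : Fin d, (Quotient.mk (hodgeSetoid lam) i' : HodgeClass lam) = q →
        (lam i).re ≤ (lam i').re := by
  obtain ⟨i₀, hi₀⟩ := Quotient.exists_rep q
  obtain ⟨i, hi, hmin⟩ := Set.exists_min_image
    {i : Fin d | (Quotient.mk (hodgeSetoid lam) i : HodgeClass lam) = q}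
    (fun i => (lam i).re) (Set.toFinite _) ⟨i₀, hi₀⟩
  exact ⟨i, hi, hmin⟩

/-- `m_q = 2 - λ`, where `λ` is the element of the class `q` with smallest real part. -/
def basePoint {d : ℕ} (lam : Fin d → ℂ) (q : HodgeClass lam) : ℂ :=
  -lam (Classical.choose (exists_smallest lam q)) + 2

/-- The Laurent series `c_q^{(n)}` in the variable `X`: `c_q^{(0)}` is the Taylor polynomial of
`γ(X + m_q)` at `X = 0` up to `O(X^{l_q})`, and
`c_q^{(n)} = c_q^{(n-1)} / ∏ₖ ((X + λₖ + m_q)/2 - n)`. -/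
def laurentC {d : ℕ} (lam : Fin d → ℂ) (q : HodgeClass lam) : ℕ → LaurentSeries ℂ
  | 0 => ∑ i ∈ Finset.range (classSize lam q),
      HahnSeries.single (i : ℤ)
        (iteratedDeriv i (gammaFactor lam) (basePoint lam q) / (i.factorial : ℂ))
  | n + 1 => laurentC lam q n /
      ∏ k, (HahnSeries.single (1 : ℤ) (1 / 2 : ℂ) +
        HahnSeries.single (0 : ℤ) ((lam k + basePoint lam q) / 2 - ((n + 1 : ℕ) : ℂ)))

/-- `c_{q,i}^{(n)}`, the coefficient of `X^{-i}` in `c_q^{(n)}`. -/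
def coeffC {d : ℕ} (lam : Fin d → ℂ) (q : HodgeClass lam) (i n : ℕ) : ℂ :=
  (laurentC lam q n).coeff (-(i : ℤ))

/-- The polynomial
`L_{α,j,k}(X) = k! ∑_{i<j} binom(i-j, k) α^{i-j-k} (-X)^i / i!` for `α ≠ 0`, and `0` for `α = 0`. -/
def polyL (α : ℂ) (j k : ℕ) : Polynomial ℂ :=
  open Classical in
  if α = 0 then 0 else
    Polynomial.C (k.factorial : ℂ) * ∑ i ∈ Finset.range j,
      Polynomial.C (((Ring.choose ((i : ℤ) - (j : ℤ)) k : ℤ) : ℂ) *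
        α ^ ((i : ℤ) - (j : ℤ) - (k : ℤ)) / (i.factorial : ℂ)) * (-Polynomial.X) ^ i

/-- `S_{q,k,s}^{(n)}(X) = ∑_{i=1}^{l_q} c_{q,i}^{(n)} L_{2n+s-m_q,i,k}(X)`. -/
def polyS {d : ℕ} (lam : Fin d → ℂ) (q : HodgeClass lam) (k : ℕ) (s : ℂ) (n : ℕ) :
    Polynomial ℂ :=
  ∑ i ∈ Finset.Icc 1 (classSize lam q),
    Polynomial.C (coeffC lam q i n) * polyL (2 * (n : ℂ) + s - basePoint lam q) i k

/-- The term `S_{q,k,s}^{(n)}(ln t) t^{2n}`. -/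
def seriesTerm {d : ℕ} (lam : Fin d → ℂ) (q : HodgeClass lam) (k : ℕ) (s : ℂ) (t : ℝ) (n : ℕ) :
    ℂ :=
  (polyS lam q k s n).eval ((Real.log t : ℝ) : ℂ) * (t : ℂ) ^ (2 * n)

/-- `G̃_{s,k}(t) = ∑_q t^{-m_q} ∑_{n ≥ 1} S_{q,k,s}^{(n)}(ln t) t^{2n}`. -/
def seriesG {d : ℕ} (lam : Fin d → ℂ) (k : ℕ) (s : ℂ) (t : ℝ) : ℂ :=
  ∑ q : HodgeClass lam,
    (t : ℂ) ^ (-basePoint lam q) * ∑' n : ℕ, seriesTerm lam q k s t (n + 1)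

/-- `∑_{n ∈ ℤ} aₙ (z - s)ⁿ` is the Laurent expansion of `f` at `s`. -/
def IsLaurentExpansion (f : ℂ → ℂ) (s : ℂ) (a : ℤ → ℂ) : Prop :=
  ∀ᶠ z in 𝓝[≠] s, HasSum (fun n : ℤ => a n * (z - s) ^ n) (f z)

end

end GammaFactor

/-! Everything is a contour shift for the integrals `∫ γ(z) t^{-z} (z - s)^{-(k+1)} dz` over
vertical lines. The line defining `φ` may be moved freely to the right of all poles (`phi_eq`). For
`Re s < σ`, with `σ` to the right of the poles, Fubini turns `G_s(t)` into `(1/2πi) ∫_{Re z = σ}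
γ(z) t^{-z} / (z - s) dz`, and differentiating `k` times in `s` gives the exponent `k + 1` and a
factor `k!` (`iteratedDeriv_incompleteMellin`).

Now move the line to `Re z = σ₀ - 2M`. The residue at `s` is, up to `k!`, the constant term of the
`k`-th derivative of `γ(S) t^{-S}`: differentiation never turns a negative power into a constant
(`exists_isLaurentExpansion_hasResidue`). The other poles are the points `m_q - 2n`, `n ≥ 1`, and
Leibniz' rule shows that their residues are the terms of `G̃` with a minus sign
(`hasResidue_gammaFactor_mul_kernel`). If `s` is itself such a point, the convention `L_0 = 0`
prevents double counting. The remaining integral tends to `0`, because `γ(z - 2)` is `γ(z)` divided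
by a product that grows as `Re z → -∞` (`tendsto_lineIntegral_zero`).

Two facts concern the coefficients. By the functional equation `γ(X + m_q - 2n)` is `γ(X + m_q)`
divided by a polynomial vanishing at `0` to order at most `l_q`, so the Taylor polynomial modulo
`X^{l_q}` determines the principal part (`hasPrincipalPart_gammaFactor`). Each step of the recursion
divides by factors of size about `n`, so the coefficients decay faster than any geometric sequence
(`exists_norm_laurentC_coeff_le`). -/

namespace GammaFactor

noncomputable section

/-! ### Residues and principal parts at an isolated singularity -/

/-- `f` has an isolated singularity at `p` with residue `c`: near `p` it is `c / (z - p)` plus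
a function with a primitive on `ℂ \ {p}` plus a function analytic at `p`. -/
def HasResidue (f : ℂ → ℂ) (p c : ℂ) : Prop :=
  ∃ U h : ℂ → ℂ, (∀ z, z ≠ p → AnalyticAt ℂ U z) ∧ AnalyticAt ℂ h p ∧
    ∀ᶠ z in 𝓝[≠] p, f z = c * (z - p)⁻¹ + deriv U z + h z

theorem HasResidue.congr {f g : ℂ → ℂ} {p c : ℂ} (hf : HasResidue f p c)
    (h : ∀ᶠ z in 𝓝[≠] p, g z = f z) : HasResidue g p c := by
  obtain ⟨U, k, hU, hk, hfe⟩ := hf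
  exact ⟨U, k, hU, hk, by filter_upwards [h, hfe] with z h1 h2 using h1.trans h2⟩

theorem HasResidue.add {f g : ℂ → ℂ} {p c e : ℂ} (hf : HasResidue f p c)
    (hg : HasResidue g p e) : HasResidue (fun z => f z + g z) p (c + e) := by
  obtain ⟨U, h, hU, hh, hfe⟩ := hf
  obtain ⟨V, k, hV, hk, hge⟩ := hg
  refine ⟨U + V, h + k, fun z hz => (hU z hz).add (hV z hz), hh.add hk, ?_⟩
  filter_upwards [hfe, hge, self_mem_nhdsWithin] with z h1 h2 h3
  rw [h1, h2, deriv_add (hU z h3).differentiableAt (hV z h3).differentiableAt]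
  simp only [Pi.add_apply]
  ring

theorem hasResidue_of_analyticAt {f : ℂ → ℂ} {p : ℂ} (hf : AnalyticAt ℂ f p) :
    HasResidue f p 0 :=
  ⟨0, f, fun _ _ => analyticAt_const, hf, by simp⟩

theorem HasResidue.const_mul {f : ℂ → ℂ} {p c : ℂ} (hf : HasResidue f p c) (b : ℂ) :
    HasResidue (fun z => b * f z) p (b * c) := by
  obtain ⟨U, h, hU, hh, hfe⟩ := hf
  refine ⟨fun z => b * U z, fun z => b * h z, fun z hz => analyticAt_const.mul (hU z hz),
    analyticAt_const.mul hh, ?_⟩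
  filter_upwards [hfe] with z h1
  rw [h1, deriv_const_mul_field]
  ring

theorem hasResidue_sum {ι : Type*} (s : Finset ι) {f : ι → ℂ → ℂ} {p : ℂ} {c : ι → ℂ}
    (hf : ∀ i ∈ s, HasResidue (f i) p (c i)) :
    HasResidue (fun z => ∑ i ∈ s, f i z) p (∑ i ∈ s, c i) := by
  classical
  induction s using Finset.induction_on with
  | empty => simpa using hasResidue_of_analyticAt (analyticAt_const (v := (0 : ℂ)) (x := p))
  | insert a s ha ih =>
    simp only [Finset.sum_insert ha]
    exact (hf a (by simp)).add (ih fun i hi => hf i (by simp [hi]))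

/-- For `i > 0` the function has the single-valued primitive `-1 / (i (z - p)^i)` off `p`, so only
`i = 0` leaves a residue. -/
theorem hasResidue_inv_pow (p : ℂ) (i : ℕ) :
    HasResidue (fun z => ((z - p) ^ (i + 1))⁻¹) p (if i = 0 then 1 else 0) := by
  rcases Nat.eq_zero_or_pos i with rfl | hi
  · exact ⟨0, 0, fun _ _ => analyticAt_const, analyticAt_const, by simp⟩
  · refine ⟨fun z => (-(i : ℂ))⁻¹ * ((z - p) ^ i)⁻¹, 0, fun z hz => ?_, analyticAt_const, ?_⟩
    · have : (z - p) ^ i ≠ 0 := pow_ne_zero _ (sub_ne_zero.2 hz)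
      fun_prop (disch := assumption)
    · filter_upwards [self_mem_nhdsWithin] with z hz
      have hzp : z - p ≠ 0 := sub_ne_zero.2 hz
      have h1 : HasDerivAt (fun z => (z - p) ^ i) ((i : ℂ) * (z - p) ^ (i - 1) * 1) z :=
        ((hasDerivAt_id z).sub_const p).pow i
      have h2 := (h1.inv (pow_ne_zero _ hzp)).const_mul ((-(i : ℂ))⁻¹)
      have h3 : deriv (fun z => (-(i : ℂ))⁻¹ * ((z - p) ^ i)⁻¹) z = _ := h2.deriv
      rw [h3]
      have hi0 : (i : ℂ) ≠ 0 := by exact_mod_cast hi.ne'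
      obtain ⟨j, rfl⟩ : ∃ j, i = j + 1 := ⟨i - 1, by omega⟩
      simp only [Nat.add_sub_cancel]
      rw [if_neg (by omega), zero_mul, zero_add, Pi.zero_apply, add_zero]
      field_simp
      ring

/-- Taylor's formula with an analytic remainder. -/
theorem taylor_of_hasFPowerSeriesAt (N : ℕ) : ∀ {g : ℂ → ℂ} {p : ℂ}
    {q : FormalMultilinearSeries ℂ ℂ ℂ}, HasFPowerSeriesAt g q p →
    ∃ r : ℂ → ℂ, AnalyticAt ℂ r p ∧
      ∀ z, g z = ∑ i ∈ Finset.range N, q.coeff i * (z - p) ^ i + (z - p) ^ N * r z := by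
  induction N with
  | zero => exact fun {g p q} h => ⟨g, ⟨q, h⟩, by simp⟩
  | succ N ih =>
    intro g p q h
    -- The remainder is an iterated `dslope`; hence the expansion is an identity for every `z`, not
    -- only near `p`.
    obtain ⟨r, hr, hg⟩ := ih h.has_fpower_series_dslope_fslope
    refine ⟨r, hr, fun z => ?_⟩
    have h0 : q.coeff 0 = g p := by
      exact h.coeff_zero 1
    have h1 : g z = g p + (z - p) * dslope g p z := by
      rw [← smul_eq_mul, sub_smul_dslope]; ring
    rw [h1, hg z, Finset.sum_range_succ', h0]
    simp only [FormalMultilinearSeries.coeff_fslope, mul_add, Finset.mul_sum]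
    have h2 : ∀ i, q.coeff (i + 1) * (z - p) ^ (i + 1) =
        (z - p) * (q.coeff (i + 1) * (z - p) ^ i) := fun i => by ring
    simp only [h2]
    ring

theorem exists_taylor {g : ℂ → ℂ} {p : ℂ} (hg : AnalyticAt ℂ g p) (N : ℕ) :
    ∃ r : ℂ → ℂ, AnalyticAt ℂ r p ∧
      ∀ z, g z = ∑ i ∈ Finset.range N, iteratedDeriv i g p / (i.factorial : ℂ) * (z - p) ^ i +
        (z - p) ^ N * r z := by
  simpa [FormalMultilinearSeries.coeff_ofScalars] using
    taylor_of_hasFPowerSeriesAt N hg.hasFPowerSeriesAt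

theorem hasResidue_mul_inv_pow {w : ℂ → ℂ} {p : ℂ} (hw : AnalyticAt ℂ w p) (i : ℕ) :
    HasResidue (fun z => ((z - p) ^ (i + 1))⁻¹ * w z) p
      (iteratedDeriv i w p / (i.factorial : ℂ)) := by
  obtain ⟨r, hr, hwz⟩ := exists_taylor hw (i + 1)
  have h1 : HasResidue (fun z => ∑ j ∈ Finset.range (i + 1),
      iteratedDeriv j w p / (j.factorial : ℂ) * ((z - p) ^ (i - j + 1))⁻¹) p
      (∑ j ∈ Finset.range (i + 1),
        iteratedDeriv j w p / (j.factorial : ℂ) * (if i - j = 0 then 1 else 0)) :=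
    hasResidue_sum _ fun j _ => (hasResidue_inv_pow p (i - j)).const_mul _
  have h2 := h1.add (hasResidue_of_analyticAt hr)
  have h3 : (∑ j ∈ Finset.range (i + 1),
      iteratedDeriv j w p / (j.factorial : ℂ) * (if i - j = 0 then 1 else 0)) + 0
      = iteratedDeriv i w p / (i.factorial : ℂ) := by
    rw [add_zero, Finset.sum_eq_single i]
    · simp
    · intro j hj hji
      have : j < i + 1 := Finset.mem_range.1 hj
      rw [if_neg (by omega), mul_zero]
    · simp
  rw [h3] at h2
  refine h2.congr ?_
  filter_upwards [self_mem_nhdsWithin] with z hz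
  have hzp : z - p ≠ 0 := sub_ne_zero.2 hz
  rw [hwz z, mul_add, Finset.mul_sum]
  congr 1
  · refine Finset.sum_congr rfl fun j hj => ?_
    have : j < i + 1 := Finset.mem_range.1 hj
    have h4 : (z - p) ^ (i + 1) = (z - p) ^ (i - j + 1) * (z - p) ^ j := by
      rw [← pow_add]; congr 1; omega
    rw [h4]
    field_simp
  · field_simp

/-- `f` equals `∑_{i<N} a i (z - p)^{-(i+1)} + h z` near `p`, with `h` analytic at `p`. -/
def HasPrincipalPart (f : ℂ → ℂ) (p : ℂ) (N : ℕ) (a : ℕ → ℂ) (h : ℂ → ℂ) : Prop :=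
  AnalyticAt ℂ h p ∧
    ∀ᶠ z in 𝓝[≠] p, f z = ∑ i ∈ Finset.range N, a i * ((z - p) ^ (i + 1))⁻¹ + h z

theorem HasPrincipalPart.hasResidue_mul {f h w : ℂ → ℂ} {p : ℂ} {N : ℕ} {a : ℕ → ℂ}
    (hf : HasPrincipalPart f p N a h) (hw : AnalyticAt ℂ w p) :
    HasResidue (fun z => f z * w z) p
      (∑ i ∈ Finset.range N, a i * (iteratedDeriv i w p / (i.factorial : ℂ))) := by
  have h1 := (hasResidue_sum (Finset.range N)
    fun i _ => (hasResidue_mul_inv_pow hw i).const_mul (a i)).add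
      (hasResidue_of_analyticAt (hf.1.mul hw))
  rw [add_zero] at h1
  refine h1.congr ?_
  filter_upwards [hf.2] with z hz
  rw [hz, add_mul, Finset.sum_mul]
  simp only [Pi.mul_apply, mul_assoc]

/-- The polar terms become poles of order at least two and lose their residue; only the Taylor
coefficient of order `k` of the analytic part survives. -/
theorem HasPrincipalPart.hasResidue_mul_inv_pow {f h : ℂ → ℂ} {p : ℂ} {N : ℕ} {a : ℕ → ℂ}
    (hf : HasPrincipalPart f p N a h) (k : ℕ) :
    HasResidue (fun z => f z * ((z - p) ^ (k + 1))⁻¹) p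
      (iteratedDeriv k h p / (k.factorial : ℂ)) := by
  have h1 := (hasResidue_sum (Finset.range N)
    fun i _ => (hasResidue_inv_pow p (i + 1 + k)).const_mul (a i)).add
      (GammaFactor.hasResidue_mul_inv_pow hf.1 k)
  simp only [Nat.add_eq_zero_iff, one_ne_zero, and_false, false_and, if_false, mul_zero,
    Finset.sum_const_zero, zero_add] at h1
  refine h1.congr ?_
  filter_upwards [hf.2] with z hz
  rw [hz, add_mul, Finset.sum_mul]
  congr 1
  · refine Finset.sum_congr rfl fun i _ => ?_
    rw [mul_assoc, ← mul_inv, ← pow_add, show i + 1 + (k + 1) = i + 1 + k + 1 by omega]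
  · ring

/-- Clearing the pole with `(z - p)^N` leaves an analytic `g`; its first `N` Taylor coefficients,
read backwards, are the new polar coefficients. -/
theorem HasPrincipalPart.mul_analytic {f h w : ℂ → ℂ} {p : ℂ} {N : ℕ} {a : ℕ → ℂ}
    (hf : HasPrincipalPart f p N a h) (hw : AnalyticAt ℂ w p) :
    ∃ b k, HasPrincipalPart (fun z => f z * w z) p N b k := by
  obtain ⟨g, hg, hge⟩ : ∃ g, AnalyticAt ℂ g p ∧
      ∀ᶠ z in 𝓝[≠] p, f z * w z = ((z - p) ^ N)⁻¹ * g z := by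
    refine ⟨fun z => (∑ i ∈ Finset.range N, a i * (z - p) ^ (N - (i + 1)) + (z - p) ^ N * h z) *
      w z, ?_, ?_⟩
    · have := hf.1
      fun_prop
    · filter_upwards [hf.2, self_mem_nhdsWithin] with z hz hzp
      have hzp : z - p ≠ 0 := sub_ne_zero.2 hzp
      rw [hz, ← mul_assoc, mul_add, Finset.mul_sum]
      congr 2
      · refine Finset.sum_congr rfl fun i hi => ?_
        have : i < N := Finset.mem_range.1 hi
        have h4 : (z - p) ^ N = (z - p) ^ (N - (i + 1)) * (z - p) ^ (i + 1) := by
          rw [← pow_add]; congr 1; omega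
        rw [h4]
        field_simp
      · field_simp
  obtain ⟨r, hr, hgz⟩ := exists_taylor hg N
  refine ⟨fun i => iteratedDeriv (N - 1 - i) g p / ((N - 1 - i).factorial : ℂ), r, hr, ?_⟩
  filter_upwards [hge, self_mem_nhdsWithin] with z hz hzp
  have hzp : z - p ≠ 0 := sub_ne_zero.2 hzp
  rw [hz, hgz z, ← Finset.sum_range_reflect, mul_add, Finset.mul_sum]
  congr 1
  · refine Finset.sum_congr rfl fun i hi => ?_
    have : i < N := Finset.mem_range.1 hi
    have h4 : (z - p) ^ N = (z - p) ^ (N - 1 - i) * (z - p) ^ (i + 1) := by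
      rw [← pow_add]; congr 1; omega
    rw [h4]
    field_simp
  · field_simp

theorem hasPrincipalPart_deriv {f h : ℂ → ℂ} {p : ℂ} {N : ℕ} {a : ℕ → ℂ}
    (hf : HasPrincipalPart f p N a h) :
    ∃ b, HasPrincipalPart (deriv f) p (N + 1) b (deriv h) := by
  -- At `i = 0` the factor `i` vanishes, so the truncated index `0 - 1` is harmless.
  refine ⟨fun i => -(i : ℂ) * a (i - 1), hf.1.deriv, ?_⟩
  have h1 := eventually_eventually_nhdsWithin.2 hf.2
  have h2 : ∀ᶠ z in 𝓝[≠] p, AnalyticAt ℂ h z :=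
    nhdsWithin_le_nhds hf.1.eventually_analyticAt
  filter_upwards [h1, h2, self_mem_nhdsWithin] with z hz hhz hzp
  have hz' : f =ᶠ[𝓝 z] fun z => ∑ i ∈ Finset.range N, a i * ((z - p) ^ (i + 1))⁻¹ + h z := by
    rwa [IsOpen.nhdsWithin_eq isOpen_compl_singleton hzp] at hz
  have hzp : z - p ≠ 0 := sub_ne_zero.2 hzp
  rw [hz'.deriv_eq, Finset.sum_range_succ']
  have h3 : ∀ i ∈ Finset.range N, HasDerivAt (fun z => a i * ((z - p) ^ (i + 1))⁻¹)
      (-((i + 1 : ℕ) : ℂ) * a i * ((z - p) ^ (i + 1 + 1))⁻¹) z := by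
    intro i _
    have h1 : HasDerivAt (fun z => (z - p) ^ (i + 1))
        (((i + 1 : ℕ) : ℂ) * (z - p) ^ (i + 1 - 1) * 1) z :=
      ((hasDerivAt_id z).sub_const p).pow (i + 1)
    refine ((h1.inv (pow_ne_zero _ hzp)).const_mul (a i)).congr_deriv ?_
    simp only [Nat.add_sub_cancel]
    field_simp
    ring
  have h4 := (HasDerivAt.fun_sum h3).add hhz.differentiableAt.hasDerivAt
  refine (HasDerivAt.deriv h4).trans ?_
  simp

theorem hasPrincipalPart_iteratedDeriv {f h : ℂ → ℂ} {p : ℂ} {N : ℕ} {a : ℕ → ℂ}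
    (hf : HasPrincipalPart f p N a h) (k : ℕ) :
    ∃ M b, HasPrincipalPart (iteratedDeriv k f) p M b (iteratedDeriv k h) := by
  induction k with
  | zero => exact ⟨N, a, by simpa using hf⟩
  | succ k ih =>
    obtain ⟨M, b, hb⟩ := ih
    obtain ⟨b', hb'⟩ := hasPrincipalPart_deriv hb
    exact ⟨M + 1, b', by simpa only [iteratedDeriv_succ] using hb'⟩

theorem HasPrincipalPart.exists_isLaurentExpansion {f h : ℂ → ℂ} {p : ℂ} {N : ℕ} {a : ℕ → ℂ}
    (hf : HasPrincipalPart f p N a h) :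
    ∃ b : ℤ → ℂ, IsLaurentExpansion f p b ∧ b 0 = h p := by
  refine ⟨fun n => if 0 ≤ n then iteratedDeriv n.toNat h p / (n.toNat.factorial : ℂ)
    else if (-n - 1).toNat < N then a (-n - 1).toNat else 0, ?_, by simp⟩
  have h1 := nhdsWithin_le_nhds (s := {p}ᶜ)
    (hasFPowerSeriesAt_iff'.1 hf.1.hasFPowerSeriesAt)
  filter_upwards [hf.2, h1] with z hz hz1
  rw [hz, add_comm]
  refine HasSum.of_nat_of_neg_add_one ?_ ?_
  · simpa [FormalMultilinearSeries.coeff_ofScalars, mul_comm] using hz1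
  · have := hasSum_sum_of_ne_finset_zero
      (f := fun m : ℕ => (if m < N then a m else 0) * ((z - p) ^ (m + 1))⁻¹)
      (L := SummationFilter.unconditional ℕ) (s := Finset.range N) (fun m hm => by
        rw [if_neg (by simpa using hm), zero_mul])
    convert this using 2 with m m hm
    · rw [if_neg (by omega), show (-(-((m : ℤ) + 1)) - 1).toNat = m by omega,
        show (-((m : ℤ) + 1)) = Int.negSucc m by omega, zpow_negSucc]
    · rw [if_pos (Finset.mem_range.1 hm)]

/-! ### The residue theorem on rectangles and vertical strips -/

open Complex (I)

/-- The integral of `f` along the boundary of the rectangle `[a, b] × [c, e]`. -/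
def rectIntegral (f : ℂ → ℂ) (a b c e : ℝ) : ℂ :=
  (∫ x in a..b, f (x + c * I)) - (∫ x in a..b, f (x + e * I)) +
    I * (∫ y in c..e, f (b + y * I)) - I * ∫ y in c..e, f (a + y * I)

theorem rectIntegral_eq_zero {f : ℂ → ℂ} {a b c e : ℝ} (hab : a ≤ b) (hce : c ≤ e)
    (hf : ∀ z : ℂ, z.re ∈ Icc a b → z.im ∈ Icc c e → DifferentiableAt ℂ f z) :
    rectIntegral f a b c e = 0 := by
  have := Complex.integral_boundary_rect_eq_zero_of_differentiableOn f ⟨a, c⟩ ⟨b, e⟩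
    (fun z hz => by
      rw [Complex.mem_reProdIm] at hz
      simp only [uIcc_of_le hab, uIcc_of_le hce] at hz
      exact (hf z hz.1 hz.2).differentiableWithinAt)
  simpa [rectIntegral] using this

/-- The boundary of the rectangle `[a, b] × [c, e]`. -/
def rectBoundary (a b c e : ℝ) : Set ℂ :=
  {z | z.re ∈ Icc a b ∧ z.im ∈ Icc c e ∧ (z.re = a ∨ z.re = b ∨ z.im = c ∨ z.im = e)}

theorem forall_mem_rectBoundary {a b c e : ℝ} (hab : a ≤ b) (hce : c ≤ e) {P : ℂ → Prop}
    (hP : ∀ z ∈ rectBoundary a b c e, P z) :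
    (∀ x ∈ uIcc a b, P (x + c * I)) ∧ (∀ x ∈ uIcc a b, P (x + e * I)) ∧
      (∀ y ∈ uIcc c e, P (b + y * I)) ∧ ∀ y ∈ uIcc c e, P (a + y * I) := by
  rw [uIcc_of_le hab, uIcc_of_le hce]
  refine ⟨fun x hx => hP _ ?_, fun x hx => hP _ ?_, fun x hx => hP _ ?_, fun x hx => hP _ ?_⟩ <;>
  simpa [rectBoundary, hab, hce] using hx

theorem intervalIntegrable_line {f : ℂ → ℂ} {z v : ℂ} {a b : ℝ}
    (hf : ∀ x ∈ uIcc a b, ContinuousAt f (z + x * v)) :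
    IntervalIntegrable (fun x : ℝ => f (z + x * v)) volume a b :=
  ContinuousOn.intervalIntegrable fun x hx =>
    (ContinuousAt.comp (f := fun x : ℝ => z + x * v) (hf x hx)
      (by fun_prop)).continuousWithinAt

theorem intervalIntegrable_horizontal {f : ℂ → ℂ} {y a b : ℝ}
    (hf : ∀ x ∈ uIcc a b, ContinuousAt f (x + y * I)) :
    IntervalIntegrable (fun x : ℝ => f (x + y * I)) volume a b := by
  simpa [add_comm] using intervalIntegrable_line (f := f) (z := y * I) (v := 1) (a := a) (b := b)
    (by simpa [add_comm] using hf)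

theorem integral_line_eq_sub {F f : ℂ → ℂ} {z v : ℂ} {a b : ℝ}
    (hF : ∀ x ∈ uIcc a b, HasDerivAt F (f (z + x * v)) (z + x * v))
    (hf : ∀ x ∈ uIcc a b, ContinuousAt f (z + x * v)) :
    v * ∫ x in a..b, f (z + x * v) = F (z + b * v) - F (z + a * v) := by
  rw [← intervalIntegral.integral_const_mul,
    ← intervalIntegral.integral_eq_sub_of_hasDerivAt (f := fun x : ℝ => F (z + x * v))]
  · intro x hx
    have h1 : HasDerivAt (fun x : ℝ => z + x * v) (1 * v) x :=
      ((Complex.ofRealCLM.hasDerivAt (x := x)).mul_const v).const_add z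
    exact ((hF x hx).comp x h1).congr_deriv (by ring)
  · exact (intervalIntegrable_line hf).const_mul v

theorem integral_horizontal_eq_sub {F f : ℂ → ℂ} {y a b : ℝ}
    (hF : ∀ x ∈ uIcc a b, HasDerivAt F (f (x + y * I)) (x + y * I))
    (hf : ∀ x ∈ uIcc a b, ContinuousAt f (x + y * I)) :
    ∫ x in a..b, f (x + y * I) = F (b + y * I) - F (a + y * I) := by
  simpa [add_comm] using integral_line_eq_sub (F := F) (f := f) (z := y * I) (v := 1) (a := a)
    (b := b) (by simpa [add_comm] using hF) (by simpa [add_comm] using hf)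

theorem rectIntegral_eq_zero_of_hasDerivAt {F f : ℂ → ℂ} {a b c e : ℝ} (hab : a ≤ b) (hce : c ≤ e)
    (hF : ∀ z ∈ rectBoundary a b c e, HasDerivAt F (f z) z)
    (hf : ∀ z ∈ rectBoundary a b c e, ContinuousAt f z) : rectIntegral f a b c e = 0 := by
  obtain ⟨h1, h2, h3, h4⟩ := forall_mem_rectBoundary hab hce hF
  obtain ⟨k1, k2, k3, k4⟩ := forall_mem_rectBoundary hab hce hf
  rw [rectIntegral, integral_horizontal_eq_sub h1 k1, integral_horizontal_eq_sub h2 k2,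
    integral_line_eq_sub h3 k3, integral_line_eq_sub h4 k4]
  ring

theorem rectIntegral_add {f g : ℂ → ℂ} {a b c e : ℝ} (hab : a ≤ b) (hce : c ≤ e)
    (hf : ∀ z ∈ rectBoundary a b c e, ContinuousAt f z)
    (hg : ∀ z ∈ rectBoundary a b c e, ContinuousAt g z) :
    rectIntegral (fun z => f z + g z) a b c e =
      rectIntegral f a b c e + rectIntegral g a b c e := by
  obtain ⟨h1, h2, h3, h4⟩ := forall_mem_rectBoundary hab hce hf
  obtain ⟨k1, k2, k3, k4⟩ := forall_mem_rectBoundary hab hce hg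
  simp only [rectIntegral]
  rw [intervalIntegral.integral_add (intervalIntegrable_horizontal h1)
      (intervalIntegrable_horizontal k1),
    intervalIntegral.integral_add (intervalIntegrable_horizontal h2)
      (intervalIntegrable_horizontal k2),
    intervalIntegral.integral_add (intervalIntegrable_line h3) (intervalIntegrable_line k3),
    intervalIntegral.integral_add (intervalIntegrable_line h4) (intervalIntegrable_line k4)]
  ring

theorem rectIntegral_const_mul (f : ℂ → ℂ) (a b c e : ℝ) (k : ℂ) :
    rectIntegral (fun z => k * f z) a b c e = k * rectIntegral f a b c e := by
  simp only [rectIntegral, intervalIntegral.integral_const_mul]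
  ring

theorem rectIntegral_congr {f g : ℂ → ℂ} {a b c e : ℝ} (hab : a ≤ b) (hce : c ≤ e)
    (h : ∀ z ∈ rectBoundary a b c e, f z = g z) :
    rectIntegral f a b c e = rectIntegral g a b c e := by
  obtain ⟨h1, h2, h3, h4⟩ := forall_mem_rectBoundary hab hce h
  rw [rectIntegral, intervalIntegral.integral_congr h1, intervalIntegral.integral_congr h2,
    intervalIntegral.integral_congr h3, intervalIntegral.integral_congr h4, rectIntegral]

theorem log_neg_of_im_pos {z : ℂ} (hz : 0 < z.im) :
    Complex.log (-z) = Complex.log z - Real.pi * I := by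
  rw [Complex.log, Complex.log, norm_neg, Complex.arg_neg_eq_arg_sub_pi_of_im_pos hz]
  push_cast
  ring

theorem log_neg_of_im_neg {z : ℂ} (hz : z.im < 0) :
    Complex.log (-z) = Complex.log z + Real.pi * I := by
  rw [Complex.log, Complex.log, norm_neg, Complex.arg_neg_eq_arg_add_pi_of_im_neg hz]
  push_cast
  ring

/-- `log (z - p)` is a primitive on the bottom, right and top sides. The left side crosses its cut,
and there `log (-(z - p))` is used; the two branches differ by `±πi` at the left corners, which adds
up to `2πi`. -/
theorem rectIntegral_inv_sub {p : ℂ} {a b c e : ℝ} (hp : p.re ∈ Ioo a b) (hp' : p.im ∈ Ioo c e) :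
    rectIntegral (fun z => (z - p)⁻¹) a b c e = 2 * Real.pi * I := by
  have hlog : ∀ z : ℂ, 0 < (z - p).re ∨ (z - p).im ≠ 0 →
      HasDerivAt (fun z => Complex.log (z - p)) (z - p)⁻¹ z := fun z hz => by
    simpa using ((hasDerivAt_id z).sub_const p).clog hz
  have hlog' : ∀ z : ℂ, (z - p).re < 0 →
      HasDerivAt (fun z => Complex.log (-(z - p))) (z - p)⁻¹ z := fun z hz => by
    have := (((hasDerivAt_id z).sub_const p).neg).clog (x := z)
      (Or.inl (by simpa using hz))
    refine this.congr_deriv ?_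
    simp only [Pi.neg_apply, id_eq, neg_div_neg_eq, one_div]
  have hc : ∀ z : ℂ, z - p ≠ 0 → ContinuousAt (fun z => (z - p)⁻¹) z := fun z hz => by
    fun_prop (disch := assumption)
  have him : ∀ z : ℂ, z.im ≠ 0 → z ≠ 0 := fun z hz h => hz (by simp [h])
  have hre : ∀ z : ℂ, z.re ≠ 0 → z ≠ 0 := fun z hz h => hz (by simp [h])
  have i1 : ∀ x : ℝ, ((x + c * I : ℂ) - p).im < 0 := fun x => by simpa using hp'.1
  have i2 : ∀ x : ℝ, 0 < ((x + e * I : ℂ) - p).im := fun x => by simpa using hp'.2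
  have i3 : ∀ y : ℝ, 0 < ((b + y * I : ℂ) - p).re := fun x => by simpa using hp.2
  have i4 : ∀ y : ℝ, ((a + y * I : ℂ) - p).re < 0 := fun x => by simpa using hp.1
  rw [rectIntegral,
    integral_horizontal_eq_sub (f := fun z => (z - p)⁻¹)
      (fun x _ => hlog _ (Or.inr (i1 x).ne)) (fun x _ => hc _ (him _ (i1 x).ne)),
    integral_horizontal_eq_sub (f := fun z => (z - p)⁻¹)
      (fun x _ => hlog _ (Or.inr (i2 x).ne')) (fun x _ => hc _ (him _ (i2 x).ne')),
    integral_line_eq_sub (f := fun z => (z - p)⁻¹)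
      (fun x _ => hlog _ (Or.inl (i3 x))) (fun x _ => hc _ (hre _ (i3 x).ne')),
    integral_line_eq_sub (f := fun z => (z - p)⁻¹)
      (fun x _ => hlog' _ (i4 x)) (fun x _ => hc _ (hre _ (i4 x).ne)),
    log_neg_of_im_neg (i1 a), log_neg_of_im_pos (i2 a)]
  ring

/-- The residue theorem for a rectangle. -/
theorem rectIntegral_eq_sum_residue {ι : Type*} {a b c e : ℝ} (hab : a ≤ b) (hce : c ≤ e)
    (s : Finset ι) (p r : ι → ℂ) (hinj : Set.InjOn p s) : ∀ f : ℂ → ℂ,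
    (∀ i ∈ s, (p i).re ∈ Ioo a b ∧ (p i).im ∈ Ioo c e ∧ HasResidue f (p i) (r i)) →
    (∀ z : ℂ, z.re ∈ Icc a b → z.im ∈ Icc c e → (∀ i ∈ s, z ≠ p i) → DifferentiableAt ℂ f z) →
    rectIntegral f a b c e = 2 * Real.pi * I * ∑ i ∈ s, r i := by
  classical
  induction s using Finset.induction_on with
  | empty =>
    intro f _ hf
    simpa using rectIntegral_eq_zero hab hce fun z h1 h2 => hf z h1 h2 (by simp)
  | insert j s hj ih =>
    intro f hr hf
    obtain ⟨hj1, hj2, U, h, hU, hh, hfe⟩ := hr j (by simp)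
    set q := p j with hq
    have hne : ∀ i ∈ s, p i ≠ q := fun i hi hpq =>
      hj (hinj (by simp) (by simp [hi]) hpq.symm ▸ hi)
    have hbd : ∀ z ∈ rectBoundary a b c e, ∀ w : ℂ, w.re ∈ Ioo a b → w.im ∈ Ioo c e → z ≠ w := by
      rintro z ⟨-, -, hz⟩ w hw1 hw2 rfl
      rcases hz with hz | hz | hz | hz
      · exact hw1.1.ne' hz
      · exact hw1.2.ne hz
      · exact hw2.1.ne' hz
      · exact hw2.2.ne hz
    -- Subtracting `PP` and filling in the value `h q` removes the singularity at `q`. As `PP` is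
    -- analytic everywhere else, the residues at the other points do not change and the induction
    -- hypothesis applies to `g`.
    set PP : ℂ → ℂ := fun z => r j * (z - q)⁻¹ + deriv U z with hPP
    have hPa : ∀ z, z ≠ q → AnalyticAt ℂ PP z := fun z hz => by
      have h1 : z - q ≠ 0 := sub_ne_zero.2 hz
      have h2 := (hU z hz).deriv
      fun_prop (disch := assumption)
    set g : ℂ → ℂ := Function.update (fun z => f z - PP z) q (h q) with hg
    have hgz : ∀ z, z ≠ q → g =ᶠ[𝓝 z] fun z => f z - PP z := fun z hz => by
      filter_upwards [isOpen_ne.mem_nhds hz] with w hw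
      exact Function.update_of_ne hw _ _
    have hgq : g =ᶠ[𝓝 q] h := by
      have := eventually_nhdsWithin_iff.1 hfe
      filter_upwards [this] with w hw
      by_cases hwq : w = q
      · rw [hwq, hg, Function.update_self]
      · rw [hg, Function.update_of_ne hwq, hw hwq]
        ring
    have hgr := ih (hinj.mono (by simp)) g (fun i hi => ?_) (fun z hz1 hz2 hz => ?_)
    · have h1 : rectIntegral f a b c e = rectIntegral (fun z => g z + PP z) a b c e := by
        refine rectIntegral_congr hab hce fun z hz => ?_
        rw [(hgz z (hbd z hz q hj1 hj2)).self_of_nhds]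
        ring
      have hfb : ∀ z ∈ rectBoundary a b c e, ContinuousAt f z := fun z hz =>
        (hf z hz.1 hz.2.1 fun i hi =>
          hbd z hz _ (hr i hi).1 (hr i hi).2.1).continuousAt
      have hPb : ∀ z ∈ rectBoundary a b c e, ContinuousAt PP z := fun z hz =>
        (hPa z (hbd z hz q hj1 hj2)).continuousAt
      have hqb : ∀ z ∈ rectBoundary a b c e, z - q ≠ 0 := fun z hz =>
        sub_ne_zero.2 (hbd z hz q hj1 hj2)
      rw [h1, rectIntegral_add hab hce
        (fun z hz => ((hfb z hz).sub (hPb z hz)).congr (hgz z (hbd z hz q hj1 hj2)).symm) hPb, hgr,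
        hPP, rectIntegral_add hab hce _ (fun z hz => ((hU z _).deriv).continuousAt),
        rectIntegral_const_mul, rectIntegral_inv_sub hj1 hj2,
        rectIntegral_eq_zero_of_hasDerivAt hab hce (F := U), Finset.sum_insert hj]
      · ring
      · exact fun z hz => (hU z (hbd z hz q hj1 hj2)).differentiableAt.hasDerivAt
      · exact fun z hz => ((hU z (hbd z hz q hj1 hj2)).deriv).continuousAt
      · intro z hz
        have := hqb z hz
        fun_prop (disch := assumption)
      · exact fun z hz => hbd z hz q hj1 hj2
    · obtain ⟨k1, k2, k3⟩ := hr i (by simp [hi])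
      refine ⟨k1, k2, ?_⟩
      have := k3.add (hasResidue_of_analyticAt (hPa (p i) (hne i hi)).neg)
      rw [add_zero] at this
      refine this.congr (nhdsWithin_le_nhds ?_)
      filter_upwards [hgz (p i) (hne i hi)] with z hz
      rw [hz, Pi.neg_apply, sub_eq_add_neg]
    · by_cases hzq : z = q
      · rw [hzq]
        exact hh.differentiableAt.congr_of_eventuallyEq hgq
      · refine DifferentiableAt.congr_of_eventuallyEq ?_ (hgz z hzq)
        refine (hf z hz1 hz2 fun i hi => ?_).sub (hPa z hzq).differentiableAt
        rcases Finset.mem_insert.1 hi with rfl | hi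
        · exact hzq
        · exact hz i hi

/-- The residue theorem for a vertical strip. -/
theorem integral_strip_eq_sum_residue {ι : Type*} {a b : ℝ} (hab : a ≤ b)
    (s : Finset ι) (p r : ι → ℂ) (hinj : Set.InjOn p s) (f : ℂ → ℂ)
    (hres : ∀ i ∈ s, (p i).re ∈ Ioo a b ∧ HasResidue f (p i) (r i))
    (hf : ∀ z : ℂ, z.re ∈ Icc a b → (∀ i ∈ s, z ≠ p i) → DifferentiableAt ℂ f z)
    (ha : Integrable fun y : ℝ => f (a + y * I)) (hb : Integrable fun y : ℝ => f (b + y * I))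
    (hdecay : ∀ ε : ℝ, 0 < ε → ∃ T : ℝ, ∀ z : ℂ, z.re ∈ Icc a b → T ≤ |z.im| → ‖f z‖ ≤ ε) :
    (∫ y : ℝ, f (b + y * I)) - ∫ y : ℝ, f (a + y * I) = 2 * Real.pi * ∑ i ∈ s, r i := by
  have hlim : ∀ σ : ℝ, (Integrable fun y : ℝ => f (σ + y * I)) →
      Tendsto (fun T : ℝ => I * ∫ y in (-T)..T, f (σ + y * I)) atTop
        (𝓝 (I * ∫ y : ℝ, f (σ + y * I))) := fun σ hσ =>
    (intervalIntegral_tendsto_integral hσ tendsto_neg_atTop_atBot tendsto_id).const_mul I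
  -- Taking `u T = -T` and `u T = T` covers both horizontal edges.
  have hhor : ∀ u : ℝ → ℝ, (∀ T, |u T| = |T|) →
      Tendsto (fun T : ℝ => ∫ x in a..b, f (x + (u T : ℝ) * I)) atTop (𝓝 0) := by
    intro u hu
    rw [Metric.tendsto_atTop]
    intro ε hε
    obtain ⟨T₀, hT₀⟩ := hdecay (ε / (2 * (b - a + 1))) (div_pos hε (by linarith))
    refine ⟨max T₀ 0, fun T hT => ?_⟩
    rw [dist_zero_right]
    have h1 := intervalIntegral.norm_integral_le_of_norm_le_const (a := a) (b := b)
      (f := fun x : ℝ => f (x + (u T : ℝ) * I)) (C := ε / (2 * (b - a + 1))) (fun x hx => by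
        rw [uIoc_of_le hab] at hx
        refine hT₀ _ (by simpa using ⟨hx.1.le, hx.2⟩) ?_
        have : T₀ ≤ |T| := (le_max_left _ _).trans (hT.trans (le_abs_self T))
        simpa [hu] using this)
    refine h1.trans_lt ?_
    rw [abs_of_nonneg (by linarith), div_mul_eq_mul_div, div_lt_iff₀ (by linarith)]
    nlinarith
  have h1 := (((hhor (fun T => -T) (fun T => abs_neg T)).sub (hhor (fun T => T)
    (fun T => rfl))).add (hlim b hb)).sub (hlim a ha)
  have h2 : ∀ᶠ T : ℝ in atTop, rectIntegral f a b (-T) T = 2 * Real.pi * I * ∑ i ∈ s, r i := by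
    have h3 : ∀ᶠ T : ℝ in atTop, ∀ i ∈ s, |(p i).im| < T := by
      rw [Filter.eventually_all_finset]
      exact fun i _ => eventually_gt_atTop _
    filter_upwards [h3, eventually_ge_atTop 0] with T hT hT0
    refine rectIntegral_eq_sum_residue hab (by linarith) s p r hinj f (fun i hi => ?_)
      (fun z hz _ hz' => hf z hz hz')
    exact ⟨(hres i hi).1, abs_lt.1 (hT i hi), (hres i hi).2⟩
  have h4 : Tendsto (fun T : ℝ => rectIntegral f a b (-T) T) atTop
      (𝓝 (2 * Real.pi * I * ∑ i ∈ s, r i)) :=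
    tendsto_const_nhds.congr' (h2.mono fun T hT => hT.symm)
  have h5 := tendsto_nhds_unique h4 (by simpa only [rectIntegral] using h1)
  have h6 : I * ((∫ y : ℝ, f (b + y * I)) - ∫ y : ℝ, f (a + y * I)) =
      I * (2 * Real.pi * ∑ i ∈ s, r i) := by
    linear_combination -h5
  exact mul_left_cancel₀ Complex.I_ne_zero h6

/-! ### Growth of the Gamma factor on vertical lines and to the left -/

theorem norm_Gamma_le {w : ℂ} (hw : 0 < w.re) : ‖Complex.Gamma w‖ ≤ Real.Gamma w.re := by
  rw [Complex.Gamma_eq_integral hw, Real.Gamma_eq_integral hw, Complex.GammaIntegral]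
  refine (norm_integral_le_integral_norm _).trans_eq ?_
  refine setIntegral_congr_fun measurableSet_Ioi fun x hx => ?_
  simp only [norm_mul, Complex.norm_real, Complex.norm_cpow_eq_rpow_re_of_pos hx]
  simp

/-- Each use of `Γ(w + 1) = w Γ(w)` divides by a number of norm at least `|Im w|`; shifting to the
right thus buys polynomial decay. -/
theorem norm_Gamma_le_div (n : ℕ) {w : ℂ} (hw : w.im ≠ 0) :
    ‖Complex.Gamma w‖ ≤ ‖Complex.Gamma (w + n)‖ / |w.im| ^ n := by
  induction n with
  | zero => simp
  | succ n ih =>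
    refine ih.trans ?_
    have h0 : 0 < |w.im| := abs_pos.2 hw
    have hn : w + n ≠ 0 := fun h => hw (by simpa using congrArg Complex.im h)
    have h1 : |w.im| ≤ ‖w + n‖ := by simpa using Complex.abs_im_le_norm (w + n)
    rw [Nat.cast_succ, ← add_assoc, Complex.Gamma_add_one _ hn, norm_mul,
      div_le_div_iff₀ (by positivity) (by positivity), pow_succ]
    have := mul_le_mul_of_nonneg_left h1
      (mul_nonneg (norm_nonneg (Complex.Gamma (w + n))) (pow_nonneg h0.le n))
    linarith

/-- A shift by `n > -a` brings the strip into the right half-plane, where `Γ` is bounded by its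
values on a compact real interval; two more shifts make the exponent at least `2`. Quadratic decay
suffices for integrability. -/
theorem exists_norm_Gamma_le (a b : ℝ) : ∃ C, 0 ≤ C ∧ ∀ w : ℂ, w.re ∈ Icc a b → 1 ≤ |w.im| →
    ‖Complex.Gamma w‖ ≤ C / |w.im| ^ 2 := by
  obtain ⟨n, hn⟩ := exists_nat_gt (-a)
  have hcont : ContinuousOn Real.Gamma (Icc (a + (n + 2 : ℕ)) (b + (n + 2 : ℕ))) :=
    Real.differentiableOn_Gamma_Ioi.continuousOn.mono fun x hx => by
      have := hx.1
      push_cast at this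
      rw [mem_Ioi]
      linarith
  obtain ⟨C, hC⟩ := isCompact_Icc.exists_bound_of_continuousOn hcont
  refine ⟨max C 0, le_max_right _ _, fun w hw hi => ?_⟩
  have hw0 : w.im ≠ 0 := fun h => by norm_num [h] at hi
  have hre : (w + (n + 2 : ℕ)).re = w.re + (n + 2 : ℕ) := by simp
  have h1 : ‖Complex.Gamma (w + (n + 2 : ℕ))‖ ≤ max C 0 := by
    refine (norm_Gamma_le ?_).trans ?_
    · rw [hre]
      push_cast
      linarith [hw.1]
    · rw [hre]
      refine (le_abs_self _).trans ((hC _ ⟨?_, ?_⟩).trans (le_max_left _ _)) <;>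
      linarith [hw.1, hw.2]
  refine (norm_Gamma_le_div (n + 2) hw0).trans ?_
  have h2 : |w.im| ^ 2 ≤ |w.im| ^ (n + 2) := pow_le_pow_right₀ hi (by omega)
  gcongr

variable {d : ℕ} (lam : Fin d → ℂ)

/-- `z` is not of the form `-λₖ - 2m` with `m ≥ 0`. -/
def IsRegular (z : ℂ) : Prop := ∀ (k : Fin d) (m : ℕ), z ≠ -lam k - 2 * m

variable {lam}

theorem isRegular_of_re {z : ℂ} (hz : ∀ k, -(lam k).re < z.re) : IsRegular lam z := by
  intro k m h
  have := hz k
  rw [h] at this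
  simp at this
  linarith [(Nat.cast_nonneg m : (0 : ℝ) ≤ m)]

theorem IsRegular.gamma_arg_ne {z : ℂ} (hz : IsRegular lam z) (k : Fin d) (m : ℕ) :
    (z + lam k) / 2 ≠ -m := fun h => hz k m (by linear_combination 2 * h)

theorem IsRegular.analyticAt {z : ℂ} (hz : IsRegular lam z) :
    AnalyticAt ℂ (gammaFactor lam) z := by
  have h1 : ∀ k, AnalyticAt ℂ (fun s => Complex.Gamma ((s + lam k) / 2)) z := by
    intro k
    have h2 : AnalyticAt ℂ (fun w => (Complex.Gamma w)⁻¹) ((z + lam k) / 2) :=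
      Complex.differentiable_one_div_Gamma.analyticAt _
    have h3 := h2.inv (inv_ne_zero (Complex.Gamma_ne_zero (hz.gamma_arg_ne k)))
    have h4 : AnalyticAt ℂ (fun s => (s + lam k) / 2) z := by fun_prop
    simpa [Function.comp_def] using h3.comp_of_eq h4 rfl
  exact Finset.analyticAt_fun_prod _ fun k _ => h1 k

/-- Functional equation of the Gamma factor. -/
theorem gammaFactor_eq_prod_mul {z : ℂ} (hz : IsRegular lam (z - 2)) :
    gammaFactor lam z = (∏ k, ((z - 2 + lam k) / 2)) * gammaFactor lam (z - 2) := by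
  rw [gammaFactor, gammaFactor, ← Finset.prod_mul_distrib]
  refine Finset.prod_congr rfl fun k _ => ?_
  rw [← Complex.Gamma_add_one _ (by simpa using hz.gamma_arg_ne k 0)]
  congr 1
  ring

/-- Far to the left every factor `(z - 2 + λₖ)/2` has norm at least `K ≥ 1/ε`, and `K ≥ 1` with `d ≥
1` passes this on to the product. This drives the decay of the shifted line integrals. -/
theorem norm_gammaFactor_sub_two_le (hd : 1 ≤ d) {ε : ℝ} (hε : 0 < ε) :
    ∃ B : ℝ, ∀ z : ℂ, z.re ≤ B → IsRegular lam (z - 2) →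
      ‖gammaFactor lam (z - 2)‖ ≤ ε * ‖gammaFactor lam z‖ := by
  set K := max 1 ε⁻¹ with hK
  refine ⟨-(2 * K + ∑ k, |(lam k).re|), fun z hz hr => ?_⟩
  have h1 : ∀ k, K ≤ ‖(z - 2 + lam k) / 2‖ := by
    intro k
    have h2 := Complex.abs_re_le_norm ((z - 2 + lam k) / 2)
    have h3 : ((z - 2 + lam k) / 2).re = (z.re - 2 + (lam k).re) / 2 := by
      rw [show (2 : ℂ) = ((2 : ℝ) : ℂ) by simp, Complex.div_ofReal_re]; simp
    have h4 : |(lam k).re| ≤ ∑ k, |(lam k).re| :=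
      Finset.single_le_sum (f := fun k => |(lam k).re|) (fun _ _ => abs_nonneg _)
        (Finset.mem_univ k)
    rw [h3] at h2
    have h5 := neg_abs_le ((z.re - 2 + (lam k).re) / 2)
    have h6 := le_abs_self (lam k).re
    linarith
  have hKpos : 1 ≤ K := le_max_left _ _
  have h2 : K ≤ ∏ k, ‖(z - 2 + lam k) / 2‖ :=
    calc K ≤ K ^ d := le_self_pow₀ hKpos (by omega)
      _ = ∏ _k : Fin d, K := by simp
      _ ≤ _ := Finset.prod_le_prod (fun _ _ => by linarith) fun k _ => h1 k
  rw [gammaFactor_eq_prod_mul hr, norm_mul, norm_prod, ← mul_assoc]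
  refine le_mul_of_one_le_left (norm_nonneg _) ?_
  have h3 : 1 = ε * ε⁻¹ := (mul_inv_cancel₀ hε.ne').symm
  rw [h3]
  exact mul_le_mul_of_nonneg_left ((le_max_right _ _).trans h2) hε.le

theorem exists_norm_gammaFactor_le (hd : 1 ≤ d) (lam : Fin d → ℂ) (a b : ℝ) :
    ∃ C T : ℝ, 0 ≤ C ∧ 1 ≤ T ∧ ∀ z : ℂ, z.re ∈ Icc a b → T ≤ |z.im| →
      ‖gammaFactor lam z‖ ≤ C / |z.im| ^ 2 := by
  choose C hC0 hC using fun k => exists_norm_Gamma_le ((a + (lam k).re) / 2) ((b + (lam k).re) / 2)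
  -- With this threshold `|Im ((z + λₖ)/2)| ≥ |Im z| / 4 ≥ 1`; squaring the quarter gives the `16`.
  refine ⟨∏ k, (16 * C k), 4 + 2 * ∑ k, |(lam k).im|,
    Finset.prod_nonneg fun k _ => by linarith [hC0 k], ?_, fun z hz hi => ?_⟩
  · have : 0 ≤ ∑ k, |(lam k).im| := Finset.sum_nonneg fun _ _ => abs_nonneg _
    linarith
  have hs : 0 ≤ ∑ k, |(lam k).im| := Finset.sum_nonneg fun _ _ => abs_nonneg _
  have h1 : ∀ k, ‖Complex.Gamma ((z + lam k) / 2)‖ ≤ 16 * C k / |z.im| ^ 2 := by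
    intro k
    have h4 : |(lam k).im| ≤ ∑ k, |(lam k).im| :=
      Finset.single_le_sum (f := fun k => |(lam k).im|) (fun _ _ => abs_nonneg _)
        (Finset.mem_univ k)
    have hre : ((z + lam k) / 2).re = (z.re + (lam k).re) / 2 := by
      rw [show (2 : ℂ) = ((2 : ℝ) : ℂ) by simp, Complex.div_ofReal_re]; simp
    have him : ((z + lam k) / 2).im = (z.im + (lam k).im) / 2 := by
      rw [show (2 : ℂ) = ((2 : ℝ) : ℂ) by simp, Complex.div_ofReal_im]; simp
    have h5 : |z.im| / 4 ≤ |((z + lam k) / 2).im| := by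
      rw [him, abs_div, abs_two]
      have := abs_sub_abs_le_abs_sub z.im (-(lam k).im)
      rw [abs_neg, sub_neg_eq_add] at this
      linarith
    refine (hC k _ ?_ ?_).trans ?_
    · rw [hre]
      constructor <;> linarith [hz.1, hz.2]
    · linarith
    · have hp : 0 < |z.im| / 4 := by linarith
      calc C k / |((z + lam k) / 2).im| ^ 2 ≤ C k / (|z.im| / 4) ^ 2 := by
            have := hC0 k
            gcongr
        _ = 16 * C k / |z.im| ^ 2 := by
            have : |z.im| ≠ 0 := (by linarith : 0 < |z.im|).ne'
            field_simp
            ring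
  rw [gammaFactor, norm_prod]
  refine (Finset.prod_le_prod (fun _ _ => norm_nonneg _) fun k _ => h1 k).trans ?_
  rw [Finset.prod_div_distrib, Finset.prod_const, Finset.card_univ, Fintype.card_fin]
  have hz1 : 1 ≤ |z.im| := by linarith
  have h6 : |z.im| ^ 2 ≤ (|z.im| ^ 2) ^ d := le_self_pow₀ (one_le_pow₀ hz1) (by omega)
  have : 0 ≤ ∏ k, (16 * C k) := Finset.prod_nonneg fun k _ => by linarith [hC0 k]
  gcongr

/-- The vertical line `Re z = σ` contains no pole. -/
def IsRegularLine (lam : Fin d → ℂ) (σ : ℝ) : Prop := ∀ y : ℝ, IsRegular lam (σ + y * I)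

theorem isRegularLine_of_gt {σ : ℝ} (hσ : ∀ k, -(lam k).re < σ) : IsRegularLine lam σ :=
  fun y => isRegular_of_re (by simpa using hσ)

theorem IsRegularLine.continuous {σ : ℝ} (hσ : IsRegularLine lam σ) :
    Continuous fun y : ℝ => gammaFactor lam (σ + y * I) :=
  continuous_iff_continuousAt.2 fun y =>
    ContinuousAt.comp (f := fun y : ℝ => (σ + y * I : ℂ)) (hσ y).analyticAt.continuousAt
      (by fun_prop)

theorem IsRegularLine.integrable (hd : 1 ≤ d) {σ : ℝ} (hσ : IsRegularLine lam σ) :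
    Integrable fun y : ℝ => gammaFactor lam (σ + y * I) := by
  obtain ⟨C, T, hC0, hT, hC⟩ := exists_norm_gammaFactor_le hd lam σ σ
  obtain ⟨K, hK⟩ := (isCompact_Icc (a := -T) (b := T)).exists_bound_of_continuousOn
    hσ.continuous.continuousOn
  have hK0 : 0 ≤ K := (norm_nonneg _).trans (hK 0 ⟨by linarith, by linarith⟩)
  refine (integrable_inv_one_add_sq.const_mul (K * (1 + T ^ 2) + 2 * C)).mono'
    hσ.continuous.aestronglyMeasurable (Eventually.of_forall fun y => ?_)
  rw [← div_eq_mul_inv, le_div_iff₀ (by positivity)]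
  by_cases hy : |y| ≤ T
  · have h1 := hK y (abs_le.1 hy)
    have h2 : y ^ 2 ≤ T ^ 2 := sq_le_sq' (abs_le.1 hy).1 (abs_le.1 hy).2
    have h3 := mul_le_mul h1 (show 1 + y ^ 2 ≤ 1 + T ^ 2 by linarith) (by positivity) hK0
    linarith
  · have h1 := hC (σ + y * I) (by simp) (by simpa using (not_le.1 hy).le)
    have hy1 : 1 ≤ |y| := by linarith
    have h2 : 1 ≤ y ^ 2 := by rw [← sq_abs]; exact one_le_pow₀ hy1
    simp only [Complex.add_im, Complex.ofReal_im, Complex.mul_im, Complex.ofReal_re, Complex.I_im,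
      mul_one, Complex.I_re, mul_zero, add_zero, zero_add, sq_abs] at h1
    rw [le_div_iff₀ (by linarith)] at h1
    have h3 : ‖gammaFactor lam (σ + y * I)‖ * (1 + y ^ 2) ≤
        2 * (‖gammaFactor lam (σ + y * I)‖ * y ^ 2) := by
      nlinarith [norm_nonneg (gammaFactor lam (σ + y * I))]
    have h4 : 0 ≤ K * (1 + T ^ 2) := by positivity
    linarith

theorem isBigO_pow_of_eventually_le {u : ℕ → ℝ} (hu0 : ∀ n, 0 ≤ u n)
    (hu : ∀ ε : ℝ, 0 < ε → ∀ᶠ n in atTop, u (n + 1) ≤ ε * u n) {r : ℝ} (hr : 0 < r) :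
    u =O[atTop] fun n => r ^ n := by
  obtain ⟨n₀, hn₀⟩ := eventually_atTop.1 (hu r hr)
  refine IsBigO.of_bound (u n₀ / r ^ n₀) ?_
  filter_upwards [eventually_ge_atTop n₀] with n hn
  induction n, hn using Nat.le_induction with
  | base =>
    rw [Real.norm_of_nonneg (hu0 _), Real.norm_of_nonneg (by positivity), div_mul_cancel₀]
    positivity
  | succ n hn ih =>
    rw [Real.norm_of_nonneg (hu0 _), Real.norm_of_nonneg (by positivity)] at ih ⊢
    calc u (n + 1) ≤ r * u n := hn₀ n hn
      _ ≤ r * (u n₀ / r ^ n₀ * r ^ n) := by gcongr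
      _ = _ := by ring

theorem integral_norm_gammaFactor_isBigO (hd : 1 ≤ d) {σ : ℝ}
    (hσ : ∀ n : ℕ, IsRegularLine lam (σ - 2 * n)) {r : ℝ} (hr : 0 < r) :
    (fun n : ℕ => ∫ y : ℝ, ‖gammaFactor lam ((σ - 2 * n : ℝ) + y * I)‖)
      =O[atTop] fun n => r ^ n := by
  refine isBigO_pow_of_eventually_le (fun n => integral_nonneg fun _ => norm_nonneg _)
    (fun ε hε => ?_) hr
  obtain ⟨B, hB⟩ := norm_gammaFactor_sub_two_le (lam := lam) hd hε
  obtain ⟨n₀, hn₀⟩ := exists_nat_ge (σ - B)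
  filter_upwards [eventually_ge_atTop n₀] with n hn
  rw [← integral_const_mul]
  refine integral_mono ((hσ (n + 1)).integrable hd).norm
    (((hσ n).integrable hd).norm.const_mul ε) fun y => ?_
  have h1 : (((σ - 2 * (n + 1 : ℕ) : ℝ) : ℂ) + y * I) =
      (((σ - 2 * n : ℝ) : ℂ) + y * I) - 2 := by
    push_cast; ring
  have h2 : (n₀ : ℝ) ≤ n := by exact_mod_cast hn
  have h3 : (0 : ℝ) ≤ n₀ := Nat.cast_nonneg _
  have h4 := hσ (n + 1) y
  rw [h1] at h4
  simp only [h1]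
  refine hB _ ?_ h4
  simp
  linarith

/-! ### The poles, indexed by equivalence classes -/

theorem exists_basePoint_eq (lam : Fin d → ℂ) (q : HodgeClass lam) : ∃ i : Fin d,
    (Quotient.mk (hodgeSetoid lam) i : HodgeClass lam) = q ∧ basePoint lam q = -lam i + 2 ∧
      ∀ i' : Fin d, (Quotient.mk (hodgeSetoid lam) i' : HodgeClass lam) = q →
        (lam i).re ≤ (lam i').re :=
  ⟨_, (Classical.choose_spec (exists_smallest lam q)).1, rfl,
    (Classical.choose_spec (exists_smallest lam q)).2⟩

/-- Consequently only indices of the class `q` can make a factor `(X + λₖ + m_q)/2 - n` vanish at `X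
= 0`. -/
theorem mk_eq_of_add_basePoint {q : HodgeClass lam} {k : Fin d} {n : ℤ}
    (h : lam k + basePoint lam q = 2 * n) :
    (Quotient.mk (hodgeSetoid lam) k : HodgeClass lam) = q := by
  obtain ⟨i, hi, hb, -⟩ := exists_basePoint_eq lam q
  rw [← hi]
  refine Quotient.sound (s := hodgeSetoid lam) ⟨n - 1, ?_⟩
  rw [hb] at h
  push_cast
  linear_combination h

/-- Poles coming from other classes are not congruent to `m_q` modulo `2`, and `m_q` lies two units
to the right of the rightmost pole of its own class. -/
theorem isRegular_basePoint (q : HodgeClass lam) : IsRegular lam (basePoint lam q) := by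
  intro k m h
  have hk : (Quotient.mk (hodgeSetoid lam) k : HodgeClass lam) = q :=
    mk_eq_of_add_basePoint (n := -m) (by rw [h]; push_cast; ring)
  obtain ⟨i, hi, hb, hmin⟩ := exists_basePoint_eq lam q
  have h1 := hmin k hk
  rw [hb] at h
  have h2 := congrArg Complex.re h
  simp at h2
  linarith [(Nat.cast_nonneg m : (0 : ℝ) ≤ m)]

/-- Every pole of the Gamma factor is one of the points `m_q - 2n`, `n ≥ 1`. -/
theorem exists_pole_eq (k : Fin d) (m : ℕ) :
    ∃ (q : HodgeClass lam) (n : ℕ), -lam k - 2 * m = basePoint lam q - 2 * (n + 1 : ℕ) := by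
  obtain ⟨i, hi, hb, hmin⟩ := exists_basePoint_eq lam (Quotient.mk (hodgeSetoid lam) k)
  obtain ⟨e, he⟩ : ∃ n : ℤ, lam k - lam i = 2 * (n : ℂ) :=
    Quotient.exact (s := hodgeSetoid lam) hi.symm
  have h1 := hmin k rfl
  have h2 : (0 : ℝ) ≤ e := by
    have := congrArg Complex.re he
    simp at this
    linarith
  have h3 : 0 ≤ e := by exact_mod_cast h2
  obtain ⟨e, rfl⟩ := Int.eq_ofNat_of_zero_le h3
  refine ⟨Quotient.mk (hodgeSetoid lam) k, e + m, ?_⟩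
  rw [hb]
  push_cast at he ⊢
  linear_combination -he

/-- Needed so that summing residues over pairs (class, `n`) counts no pole twice. -/
theorem basePoint_sub_injective :
    Function.Injective fun x : HodgeClass lam × ℕ =>
      basePoint lam x.1 - 2 * ((x.2 + 1 : ℕ) : ℂ) := by
  rintro ⟨q, n⟩ ⟨q', n'⟩ h
  obtain ⟨i, hi, hb, -⟩ := exists_basePoint_eq lam q
  simp only at h
  have hq : q = q' := by
    rw [← hi]
    refine mk_eq_of_add_basePoint (n := 1 - n + n') ?_
    rw [hb] at h
    push_cast at h ⊢
    linear_combination -h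
  subst hq
  have : (n : ℂ) = n' := by
    push_cast at h
    linear_combination (-1 / 2) * h
  rw [Prod.mk.injEq]
  exact ⟨rfl, by exact_mod_cast this⟩

theorem eventually_isRegular (lam : Fin d → ℂ) (z₀ : ℂ) : ∀ᶠ z in 𝓝[≠] z₀, IsRegular lam z := by
  unfold IsRegular
  rw [eventually_all]
  intro k
  obtain ⟨M, hM⟩ := exists_nat_gt (‖z₀‖ + 1 + ‖lam k‖)
  have h1 : ∀ᶠ z in 𝓝[≠] z₀, ∀ m ∈ Finset.range M, z ≠ -lam k - 2 * m := by
    rw [Filter.eventually_all_finset]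
    intro m _
    by_cases h : z₀ = -lam k - 2 * m
    · rw [← h]
      exact self_mem_nhdsWithin
    · exact nhdsWithin_le_nhds (isOpen_ne.mem_nhds h)
  have h2 : ∀ᶠ z in 𝓝[≠] z₀, z ∈ Metric.ball z₀ 1 :=
    nhdsWithin_le_nhds (Metric.ball_mem_nhds _ one_pos)
  filter_upwards [h1, h2] with z hz1 hz2 m hm
  refine hz1 m (Finset.mem_range.2 ?_) hm
  have h3 : ‖z‖ < ‖z₀‖ + 1 := by
    rw [Metric.mem_ball, dist_eq_norm] at hz2
    have := norm_le_norm_add_norm_sub' z z₀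
    linarith
  have h4 : (2 * m : ℂ) = -lam k - z := by rw [hm]; ring
  have h5 : 2 * (m : ℝ) ≤ ‖lam k‖ + ‖z‖ := by
    have := norm_sub_le (-lam k) z
    rw [← h4, norm_neg] at this
    simpa using this
  have h6 : (m : ℝ) < M := by linarith [(Nat.cast_nonneg m : (0 : ℝ) ≤ m)]
  exact_mod_cast h6

theorem gammaFactor_eq_prod_range_mul (n : ℕ) {z : ℂ} (hz : IsRegular lam (z - 2 * n)) :
    gammaFactor lam z =
      (∏ j ∈ Finset.range n, ∏ k, ((z + lam k) / 2 - (j + 1 : ℕ))) *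
        gammaFactor lam (z - 2 * n) := by
  induction n with
  | zero => simp
  | succ n ih =>
    have h1 : IsRegular lam (z - 2 * n) := fun k m h => hz k (m + 1) (by
      push_cast
      linear_combination h)
    have h2 : z - 2 * ((n + 1 : ℕ) : ℂ) = z - 2 * n - 2 := by push_cast; ring
    rw [h2] at hz ⊢
    rw [ih h1, gammaFactor_eq_prod_mul hz, Finset.prod_range_succ, mul_assoc]
    congr 2
    refine Finset.prod_congr rfl fun k _ => ?_
    push_cast
    ring

/-! ### The coefficients `c_{q,i}^{(n)}` and principal parts of the Gamma factor -/

open Polynomial in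
/-- The polynomial `(X + λₖ + m_q)/2 - n`. -/
def shiftFactor (lam : Fin d → ℂ) (q : HodgeClass lam) (n : ℕ) (k : Fin d) : ℂ[X] :=
  C (1 / 2) * X + C ((lam k + basePoint lam q) / 2 - n)

/-- The product of the factors `shiftFactor` up to `n`. -/
def shiftProd (lam : Fin d → ℂ) (q : HodgeClass lam) (n : ℕ) : Polynomial ℂ :=
  ∏ j ∈ Finset.range n, ∏ k, shiftFactor lam q (j + 1) k

theorem eval_shiftProd (q : HodgeClass lam) (n : ℕ) (x : ℂ) : (shiftProd lam q n).eval x =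
    ∏ j ∈ Finset.range n, ∏ k, ((x + basePoint lam q + lam k) / 2 - (j + 1 : ℕ)) := by
  simp only [shiftProd, shiftFactor, Polynomial.eval_prod]
  refine Finset.prod_congr rfl fun j _ => Finset.prod_congr rfl fun k _ => ?_
  simp only [Polynomial.eval_add, Polynomial.eval_mul, Polynomial.eval_C, Polynomial.eval_X]
  ring

-- `v` counts the pairs `(j, k)` whose factor vanishes at `0`. Such a `k` lies in the class `q` and
-- determines `j`, so there are at most `l_q` pairs.
open Polynomial in
theorem exists_shiftProd_eq (q : HodgeClass lam) (n : ℕ) : ∃ (v : ℕ) (E : ℂ[X]),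
    v ≤ classSize lam q ∧ shiftProd lam q n = X ^ v * E ∧ E.coeff 0 ≠ 0 := by
  classical
  set b : ℕ × Fin d → ℂ := fun x => (lam x.2 + basePoint lam q) / 2 - (x.1 + 1 : ℕ) with hb
  set S : Finset (ℕ × Fin d) := Finset.range n ×ˢ Finset.univ with hS
  have hP : ∀ x : ℕ × Fin d, shiftFactor lam q (x.1 + 1) x.2 = C (1 / 2) * X + C (b x) :=
    fun x => rfl
  refine ⟨(S.filter fun x => b x = 0).card, C ((1 / 2) ^ (S.filter fun x => b x = 0).card) *
    ∏ x ∈ S.filter (fun x => ¬ b x = 0), shiftFactor lam q (x.1 + 1) x.2, ?_, ?_, ?_⟩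
  · rw [classSize, Nat.card_eq_fintype_card, Fintype.card_subtype]
    have key : ∀ x ∈ S.filter (fun x => b x = 0),
        lam x.2 + basePoint lam q = 2 * ((x.1 + 1 : ℕ) : ℤ) := by
      intro x hx
      have := (Finset.mem_filter.1 hx).2
      simp only [hb] at this
      push_cast at this ⊢
      linear_combination 2 * this
    refine Finset.card_le_card_of_injOn Prod.snd (fun x hx => ?_) (fun x hx y hy hxy => ?_)
    · simpa using mk_eq_of_add_basePoint (key x hx)
    · have h1 := key x hx
      have h2 := key y hy
      rw [hxy, h2] at h1
      have h3 : ((y.1 + 1 : ℕ) : ℂ) = ((x.1 + 1 : ℕ) : ℂ) := by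
        push_cast at h1 ⊢
        linear_combination h1 / 2
      have h4 : y.1 + 1 = x.1 + 1 := by exact_mod_cast h3
      exact Prod.ext (by omega) hxy
  · rw [shiftProd, ← Finset.prod_product', ← Finset.prod_filter_mul_prod_filter_not S
      (fun x => b x = 0), ← mul_assoc]
    congr 1
    rw [Finset.prod_congr rfl (g := fun _ => C (1 / 2 : ℂ) * X), Finset.prod_const, mul_pow,
      mul_comm, C_pow]
    intro x hx
    rw [hP, (Finset.mem_filter.1 hx).2, C_0, add_zero]
  · rw [coeff_zero_eq_eval_zero, eval_mul, eval_C, eval_prod]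
    refine mul_ne_zero (pow_ne_zero _ (by norm_num)) (Finset.prod_ne_zero_iff.2 fun x hx => ?_)
    rw [hP]
    simpa using (Finset.mem_filter.1 hx).2

/-- Polynomials as Laurent series. -/
def toLaurent : Polynomial ℂ →+* LaurentSeries ℂ :=
  (HahnSeries.ofPowerSeries ℤ ℂ).comp Polynomial.coeToPowerSeries.ringHom

theorem toLaurent_apply (P : Polynomial ℂ) :
    toLaurent P = HahnSeries.ofPowerSeries ℤ ℂ (P : PowerSeries ℂ) := rfl

theorem toLaurent_X : toLaurent Polynomial.X = HahnSeries.single (1 : ℤ) (1 : ℂ) := by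
  simp [toLaurent_apply]

theorem toLaurent_C (x : ℂ) : toLaurent (Polynomial.C x) = HahnSeries.single (0 : ℤ) x := by
  rw [toLaurent_apply, Polynomial.coe_C, HahnSeries.ofPowerSeries_C]
  rfl

theorem toLaurent_injective : Function.Injective toLaurent :=
  HahnSeries.ofPowerSeries_injective.comp (Polynomial.coe_injective ℂ)

theorem toLaurent_shiftFactor (q : HodgeClass lam) (n : ℕ) (k : Fin d) :
    toLaurent (shiftFactor lam q n k) = HahnSeries.single (1 : ℤ) (1 / 2 : ℂ) +
      HahnSeries.single (0 : ℤ) ((lam k + basePoint lam q) / 2 - (n : ℂ)) := by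
  rw [shiftFactor, map_add, map_mul, toLaurent_X, toLaurent_C, toLaurent_C,
    HahnSeries.single_mul_single]
  simp

theorem laurentC_succ (q : HodgeClass lam) (n : ℕ) : laurentC lam q (n + 1) =
    laurentC lam q n / ∏ k, toLaurent (shiftFactor lam q (n + 1) k) := by
  simp only [toLaurent_shiftFactor]
  rfl

theorem shiftFactor_ne_zero (q : HodgeClass lam) (n : ℕ) (k : Fin d) :
    shiftFactor lam q n k ≠ 0 := by
  intro h
  have := congrArg (fun P => Polynomial.coeff P 1) h
  simp [shiftFactor] at this

theorem toLaurent_shiftFactor_ne_zero (q : HodgeClass lam) (n : ℕ) (k : Fin d) :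
    toLaurent (shiftFactor lam q n k) ≠ 0 :=
  (map_ne_zero_iff _ toLaurent_injective).2 (shiftFactor_ne_zero q n k)

/-- The Taylor polynomial of the Gamma factor at `m_q`. -/
def taylorPoly (lam : Fin d → ℂ) (q : HodgeClass lam) : Polynomial ℂ :=
  ∑ i ∈ Finset.range (classSize lam q), Polynomial.C
    (iteratedDeriv i (gammaFactor lam) (basePoint lam q) / (i.factorial : ℂ)) * Polynomial.X ^ i

theorem laurentC_zero (q : HodgeClass lam) : laurentC lam q 0 = toLaurent (taylorPoly lam q) := by
  rw [taylorPoly, map_sum, laurentC]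
  refine Finset.sum_congr rfl fun i _ => ?_
  rw [map_mul, map_pow, toLaurent_X, toLaurent_C, HahnSeries.single_pow,
    HahnSeries.single_mul_single]
  simp

theorem laurentC_mul_shiftProd (q : HodgeClass lam) (n : ℕ) :
    laurentC lam q n * toLaurent (shiftProd lam q n) = toLaurent (taylorPoly lam q) := by
  induction n with
  | zero => rw [shiftProd, Finset.prod_range_zero, map_one, mul_one, laurentC_zero]
  | succ n ih =>
    rw [← ih, shiftProd, Finset.prod_range_succ, map_mul, ← shiftProd, laurentC_succ, map_prod,
      mul_comm (toLaurent (shiftProd lam q n)), ← mul_assoc, div_mul_cancel₀]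
    exact Finset.prod_ne_zero_iff.2 fun k _ => toLaurent_shiftFactor_ne_zero q _ k

-- Bézout for the coprime polynomials `E` and `X^l`. Read as `P / (X^v E) = A / X^l - B / E`, it
-- isolates the polar part in `A`; being polynomial, it can be used both for Laurent series and for
-- functions.
open Polynomial in
theorem exists_mul_eq_of_coeff_ne_zero {v l : ℕ} (hv : v ≤ l) {E : ℂ[X]} (hE : E.coeff 0 ≠ 0)
    (P : ℂ[X]) : ∃ A B : ℂ[X], A * (X ^ v * E) = X ^ l * P + X ^ (l + v) * B := by
  have h1 : IsCoprime E (X ^ l) := by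
    refine IsCoprime.pow_right ?_
    refine IsCoprime.symm ((irreducible_X.coprime_iff_not_dvd).2 ?_)
    rwa [X_dvd_iff]
  obtain ⟨a, b, hab⟩ := h1
  refine ⟨X ^ (l - v) * P * a, -(X ^ (l - v) * P * b), ?_⟩
  have h2 : (X : ℂ[X]) ^ l = X ^ (l - v) * X ^ v := by rw [← pow_add]; congr 1; omega
  rw [pow_add]
  calc X ^ (l - v) * P * a * (X ^ v * E) = X ^ (l - v) * X ^ v * P * (a * E) := by ring
    _ = X ^ l * P * (1 - b * X ^ l) := by rw [← h2, ← hab]; ring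
    _ = X ^ l * P - X ^ l * (X ^ (l - v) * X ^ v) * P * b := by rw [← h2]; ring
    _ = _ := by ring

/-- The numbers `c_{q,i}^{(n)}` are the coefficients of the principal part of the Gamma factor
at `m_q - 2n`. -/
theorem hasPrincipalPart_gammaFactor (q : HodgeClass lam) (n : ℕ) :
    ∃ h, HasPrincipalPart (gammaFactor lam) (basePoint lam q - 2 * n) (classSize lam q)
      (fun i => coeffC lam q (i + 1) n) h := by
  obtain ⟨v, E, hv, hD, hE⟩ := exists_shiftProd_eq q n
  set l := classSize lam q with hl
  set m := basePoint lam q with hm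
  obtain ⟨A, B, hAB⟩ := exists_mul_eq_of_coeff_ne_zero hv hE (taylorPoly lam q)
  have hE0 : E ≠ 0 := fun h => hE (by simp [h])
  -- Formal side: the Laurent series `c^{(n)}` is `A / X^l - B / E`, and `B / E` is a power series
  -- since `E` has nonzero constant term, so negative powers come from `A` alone.
  have hcoeff : ∀ i < l, coeffC lam q (i + 1) n = A.coeff (l - 1 - i) := by
    have hEu : (E : PowerSeries ℂ) * (E : PowerSeries ℂ)⁻¹ = 1 :=
      PowerSeries.mul_inv_cancel _ (by simpa using hE)
    have hEL := congrArg (HahnSeries.ofPowerSeries ℤ ℂ) hEu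
    rw [map_mul, map_one, ← toLaurent_apply] at hEL
    set G := HahnSeries.ofPowerSeries ℤ ℂ (E : PowerSeries ℂ)⁻¹ with hG
    have h1 := laurentC_mul_shiftProd q n
    have h2 := congrArg toLaurent hAB
    rw [hD] at h1
    simp only [map_mul, map_add, map_pow] at h1 h2
    have hX : toLaurent Polynomial.X ≠ 0 :=
      (map_ne_zero_iff _ toLaurent_injective).2 Polynomial.X_ne_zero
    have h3 : laurentC lam q n * toLaurent Polynomial.X ^ l =
        toLaurent A - toLaurent Polynomial.X ^ l * (toLaurent B * G) := by
      have h4 : toLaurent Polynomial.X ^ v * (laurentC lam q n * toLaurent Polynomial.X ^ l) =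
          toLaurent Polynomial.X ^ v *
            (toLaurent A - toLaurent Polynomial.X ^ l * (toLaurent B * G)) := by
        rw [← h1, pow_add] at h2
        linear_combination (toLaurent Polynomial.X ^ v * toLaurent A -
          laurentC lam q n * toLaurent Polynomial.X ^ l * toLaurent Polynomial.X ^ v) * hEL - G * h2
      exact mul_left_cancel₀ (pow_ne_zero _ hX) h4
    intro i hi
    have h5 := congrArg (fun F : LaurentSeries ℂ => F.coeff ((l - 1 - i : ℕ) : ℤ)) h3
    rw [toLaurent_X, HahnSeries.single_pow, one_pow, nsmul_one] at h5
    have h6 : (((l - 1 - i : ℕ) : ℤ)) = -((i + 1 : ℕ) : ℤ) + (l : ℤ) := by omega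
    have h7 : toLaurent B * G = HahnSeries.ofPowerSeries ℤ ℂ
        ((B : PowerSeries ℂ) * (E : PowerSeries ℂ)⁻¹) := by
      rw [map_mul]; rfl
    have h8 : (HahnSeries.single (l : ℤ) (1 : ℂ) * (toLaurent B * G)).coeff
        ((l - 1 - i : ℕ) : ℤ) = 0 := by
      rw [h6, HahnSeries.coeff_single_mul_add, h7, PowerSeries.coeff_coe, if_pos (by omega),
        mul_zero]
    have h9 : (toLaurent A).coeff ((l - 1 - i : ℕ) : ℤ) = A.coeff (l - 1 - i) := by
      rw [toLaurent_apply, LaurentSeries.coeff_coe_powerSeries, Polynomial.coeff_coe]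
    simp only [HahnSeries.coeff_sub] at h5
    rw [h8, h9, sub_zero, h6, HahnSeries.coeff_mul_single_add, mul_one] at h5
    rw [coeffC, h5]
  obtain ⟨r, hr, hγ⟩ := exists_taylor (isRegular_basePoint q).analyticAt l
  set p := m - 2 * (n : ℂ) with hp
  -- Analytic side: the high part of `A / x^l`, the term `-B / E`, and the Taylor error `x^l r /
  -- (x^v E)`. The last is analytic because `v ≤ l`, which is why truncation modulo `X^l` loses
  -- nothing polar.
  refine ⟨fun z => ∑ j ∈ Finset.range (A.natDegree + 1), A.coeff (l + j) * (z - p) ^ j -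
    B.eval (z - p) / E.eval (z - p) +
    (z - p) ^ (l - v) * r (z - p + m) / E.eval (z - p), ?_, ?_⟩
  · have e1 : AnalyticAt ℂ (fun z => E.eval (z - p)) p :=
      (Differentiable.analyticAt (by fun_prop) p)
    have e2 : E.eval (p - p) ≠ 0 := by
      rw [sub_self, ← Polynomial.coeff_zero_eq_eval_zero]; exact hE
    have e3 : AnalyticAt ℂ (fun z => B.eval (z - p)) p :=
      (Differentiable.analyticAt (by fun_prop) p)
    have e4 : AnalyticAt ℂ (fun z => r (z - p + m)) p := by
      have h1 : AnalyticAt ℂ (fun z : ℂ => z - p + m) p := by fun_prop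
      have h2 := hr.comp_of_eq h1 (by ring)
      simpa [Function.comp_def] using h2
    have e5 : AnalyticAt ℂ (fun z => ∑ j ∈ Finset.range (A.natDegree + 1),
        A.coeff (l + j) * (z - p) ^ j) p := by fun_prop
    have e6 : AnalyticAt ℂ (fun z => (z - p) ^ (l - v)) p := by fun_prop
    exact (e5.fun_sub (e3.fun_div e1 e2)).fun_add ((e6.fun_mul e4).fun_div e1 e2)
  · have f1 : ∀ᶠ z in 𝓝[≠] p, E.eval (z - p) ≠ 0 := by
      refine nhdsWithin_le_nhds (ContinuousAt.eventually_ne (by fun_prop) ?_)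
      rw [sub_self, ← Polynomial.coeff_zero_eq_eval_zero]; exact hE
    filter_upwards [f1, eventually_isRegular lam p, self_mem_nhdsWithin] with z hz1 hz2 hz3
    have hx : z - p ≠ 0 := sub_ne_zero.2 hz3
    set x := z - p with hxdef
    have hzx : z = x + m - 2 * n := by rw [hxdef, hp]; ring
    have g1 := gammaFactor_eq_prod_range_mul n (z := x + m) (by rwa [← hzx])
    rw [← hzx, ← eval_shiftProd, hD, hγ (x + m)] at g1
    have g2 : (taylorPoly lam q).eval x = ∑ i ∈ Finset.range l,
        iteratedDeriv i (gammaFactor lam) m / (i.factorial : ℂ) * (x + m - m) ^ i := by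
      simp [taylorPoly, Polynomial.eval_finsetSum, hl, hm]
    rw [← g2, add_sub_cancel_right] at g1
    have g3 := congrArg (Polynomial.eval x) hAB
    simp only [Polynomial.eval_mul, Polynomial.eval_add, Polynomial.eval_pow,
      Polynomial.eval_X] at g1 g3
    have g4 : A.eval x = ∑ i ∈ Finset.range l, A.coeff i * x ^ i +
        x ^ l * ∑ j ∈ Finset.range (A.natDegree + 1), A.coeff (l + j) * x ^ j := by
      rw [Polynomial.eval_eq_sum_range' (n := l + (A.natDegree + 1)) (by omega),
        Finset.sum_range_add, Finset.mul_sum]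
      congr 1
      exact Finset.sum_congr rfl fun j _ => by ring
    have g5 : ∑ i ∈ Finset.range l, coeffC lam q (i + 1) n * (x ^ (i + 1))⁻¹ =
        (x ^ l)⁻¹ * ∑ i ∈ Finset.range l, A.coeff i * x ^ i := by
      rw [← Finset.sum_range_reflect (fun i => A.coeff i * x ^ i), Finset.mul_sum]
      refine Finset.sum_congr rfl fun i hi => ?_
      have hil : i < l := Finset.mem_range.1 hi
      rw [hcoeff i hil]
      have h4 : x ^ l = x ^ (l - 1 - i) * x ^ (i + 1) := by
        rw [← pow_add]; congr 1; omega
      rw [h4]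
      field_simp
    have g6 : x ^ l = x ^ (l - v) * x ^ v := by rw [← pow_add]; congr 1; omega
    have hxl : x ^ l ≠ 0 := pow_ne_zero _ hx
    have hxv : x ^ v ≠ 0 := pow_ne_zero _ hx
    have g7 : x ^ l * (x ^ v * Polynomial.eval x E) * gammaFactor lam z =
        x ^ l * (x ^ v * Polynomial.eval x E) *
        (∑ i ∈ Finset.range l, coeffC lam q (i + 1) n * (x ^ (i + 1))⁻¹ +
        (∑ j ∈ Finset.range (A.natDegree + 1), A.coeff (l + j) * x ^ j -
          Polynomial.eval x B / Polynomial.eval x E +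
          x ^ (l - v) * r (x + m) / Polynomial.eval x E)) := by
      rw [g5]
      have k1 : x ^ l * (x ^ v * Polynomial.eval x E) * gammaFactor lam z =
          x ^ l * (Polynomial.eval x (taylorPoly lam q) + x ^ l * r (x + m)) := by
        rw [g1]; ring
      rw [k1, mul_add, ← sub_eq_iff_eq_add.2 g3, g4]
      field_simp
      rw [g6, pow_add, g6]
      ring
    exact mul_left_cancel₀ (mul_ne_zero hxl (mul_ne_zero hxv hz1)) g7

/-! ### Superexponential convergence of the series -/

/-- Comparing coefficients gives `F_{-i-1} = G_{-i-2} / 2 + b G_{-i-1}`. Starting from the far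
negative coefficients of `G`, which vanish, one recovers the others in turn; the bound reproduces
itself because `C + (C/K)/2 = (K + 1/2)(C/K)`. -/
theorem norm_coeff_le_of_mul_eq {F G : LaurentSeries ℂ} {b : ℂ} {K C : ℝ} (hK : 0 < K)
    (hC : 0 ≤ C) (hb : K + 1 / 2 ≤ ‖b‖)
    (hG : G * (HahnSeries.single (1 : ℤ) (1 / 2 : ℂ) + HahnSeries.single (0 : ℤ) b) = F)
    (hF : ∀ i : ℕ, ‖F.coeff (-((i : ℤ) + 1))‖ ≤ C) (i : ℕ) :
    ‖G.coeff (-((i : ℤ) + 1))‖ ≤ C / K := by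
  have hrec : ∀ i : ℕ, F.coeff (-((i : ℤ) + 1)) =
      G.coeff (-(((i + 1 : ℕ) : ℤ) + 1)) * (1 / 2) + G.coeff (-((i : ℤ) + 1)) * b := by
    intro i
    rw [← hG, mul_add, HahnSeries.coeff_add]
    congr 1
    · rw [show (-((i : ℤ) + 1)) = -(((i + 1 : ℕ) : ℤ) + 1) + 1 by push_cast; ring,
        HahnSeries.coeff_mul_single_add]
    · conv_lhs => rw [show (-((i : ℤ) + 1)) = -((i : ℤ) + 1) + 0 by ring]
      rw [HahnSeries.coeff_mul_single_add]
  obtain ⟨M, hM⟩ : ∃ M : ℕ, ∀ i, M ≤ i → G.coeff (-((i : ℤ) + 1)) = 0 := by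
    refine ⟨(-G.order).toNat, fun i hi => HahnSeries.coeff_eq_zero_of_lt_order ?_⟩
    omega
  by_cases hi : M ≤ i
  · rw [hM i hi, norm_zero]
    positivity
  · have key : ∀ j ≤ M, ‖G.coeff (-(((M - j : ℕ) : ℤ) + 1))‖ ≤ C / K := by
      intro j
      induction j with
      | zero =>
        intro _
        rw [hM _ (by omega), norm_zero]
        positivity
      | succ j ih =>
        intro hj
        have h1 := ih (by omega)
        have h2 := hrec (M - (j + 1))
        rw [show M - (j + 1) + 1 = M - j by omega] at h2
        have h3 : G.coeff (-(((M - (j + 1) : ℕ) : ℤ) + 1)) * b =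
            F.coeff (-(((M - (j + 1) : ℕ) : ℤ) + 1)) -
              G.coeff (-(((M - j : ℕ) : ℤ) + 1)) * (1 / 2) := by rw [h2]; ring
        have h4 := congrArg norm h3
        rw [norm_mul] at h4
        have h5 := norm_sub_le (F.coeff (-(((M - (j + 1) : ℕ) : ℤ) + 1)))
          (G.coeff (-(((M - j : ℕ) : ℤ) + 1)) * (1 / 2))
        rw [norm_mul, ← h4, show ‖(1 / 2 : ℂ)‖ = 1 / 2 by norm_num] at h5
        have h6 := hF (M - (j + 1))
        have h7 : (K + 1 / 2) * (C / K) = C + C / K * (1 / 2) := by field_simp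
        have h8 := mul_le_mul_of_nonneg_left hb
          (norm_nonneg (G.coeff (-(((M - (j + 1) : ℕ) : ℤ) + 1))))
        have h9 : (K + 1 / 2) * ‖G.coeff (-(((M - (j + 1) : ℕ) : ℤ) + 1))‖ ≤
            (K + 1 / 2) * (C / K) := by
          rw [h7]
          linarith
        exact le_of_mul_le_mul_left h9 (by linarith)
    have := key (M - i) (by omega)
    rwa [show M - (M - i) = i by omega] at this

theorem norm_coeff_div_prod_le {ι : Type*} (s : Finset ι) {b : ι → ℂ} {K C : ℝ} (hK : 0 < K)
    (hC : 0 ≤ C) (hb : ∀ k ∈ s, K + 1 / 2 ≤ ‖b k‖) {F : LaurentSeries ℂ}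
    (hF : ∀ i : ℕ, ‖F.coeff (-((i : ℤ) + 1))‖ ≤ C) (i : ℕ) :
    ‖(F / ∏ k ∈ s, (HahnSeries.single (1 : ℤ) (1 / 2 : ℂ) +
      HahnSeries.single (0 : ℤ) (b k))).coeff (-((i : ℤ) + 1))‖ ≤ C / K ^ s.card := by
  classical
  induction s using Finset.induction_on generalizing i with
  | empty => simpa using hF i
  | insert k s hk ih =>
    rw [Finset.prod_insert hk, Finset.card_insert_of_notMem hk, pow_succ,
      mul_comm (HahnSeries.single _ _ + _), ← div_div, ← div_div]
    refine norm_coeff_le_of_mul_eq hK (by positivity) (hb k (by simp)) (div_mul_cancel₀ _ ?_)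
      (ih fun k' hk' => hb k' (by simp [hk'])) i
    intro h
    have := congrArg (fun F : LaurentSeries ℂ => F.coeff 1) h
    simp at this

/-- Past `n₀` all constant terms exceed `K + 1/2` in norm, so each step gains `K^d ≥ 1/r`. At `n₀`
only finitely many polar coefficients are nonzero, which supplies the initial bound. -/
theorem exists_norm_laurentC_coeff_le (hd : 1 ≤ d) (q : HodgeClass lam) {r : ℝ} (hr : 0 < r) :
    ∃ (C : ℝ) (n₀ : ℕ), 0 ≤ C ∧ ∀ n, n₀ ≤ n → ∀ i : ℕ,
      ‖(laurentC lam q n).coeff (-((i : ℤ) + 1))‖ ≤ C * r ^ n := by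
  set K := max 1 r⁻¹ with hK
  have hK1 : 1 ≤ K := le_max_left _ _
  obtain ⟨n₀, hn₀⟩ := exists_nat_ge (K + 1 / 2 + ∑ k, ‖(lam k + basePoint lam q) / 2‖)
  obtain ⟨C, hC0, hC⟩ : ∃ C, 0 ≤ C ∧
      ∀ i : ℕ, ‖(laurentC lam q n₀).coeff (-((i : ℤ) + 1))‖ ≤ C := by
    set G := laurentC lam q n₀
    refine ⟨∑ i ∈ Finset.range (-G.order).toNat, ‖G.coeff (-((i : ℤ) + 1))‖,
      Finset.sum_nonneg fun _ _ => norm_nonneg _, fun i => ?_⟩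
    by_cases hi : i < (-G.order).toNat
    · exact Finset.single_le_sum (f := fun i : ℕ => ‖G.coeff (-((i : ℤ) + 1))‖)
        (fun _ _ => norm_nonneg _) (Finset.mem_range.2 hi)
    · rw [HahnSeries.coeff_eq_zero_of_lt_order (by omega), norm_zero]
      exact Finset.sum_nonneg fun _ _ => norm_nonneg _
  refine ⟨C / r ^ n₀, n₀, by positivity, fun n hn => ?_⟩
  induction n, hn using Nat.le_induction with
  | base => rwa [div_mul_cancel₀ _ (by positivity)]
  | succ n hn ih =>
    intro i
    have hb : ∀ k ∈ Finset.univ, K + 1 / 2 ≤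
        ‖(lam k + basePoint lam q) / 2 - ((n + 1 : ℕ) : ℂ)‖ := by
      intro k _
      have h1 : ‖(lam k + basePoint lam q) / 2‖ ≤ ∑ k, ‖(lam k + basePoint lam q) / 2‖ :=
        Finset.single_le_sum (f := fun k => ‖(lam k + basePoint lam q) / 2‖)
          (fun _ _ => norm_nonneg _) (Finset.mem_univ k)
      have h2 := norm_sub_norm_le ((n + 1 : ℕ) : ℂ) ((lam k + basePoint lam q) / 2)
      rw [norm_sub_rev, Complex.norm_natCast] at h2
      have h3 : (n₀ : ℝ) ≤ n := by exact_mod_cast hn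
      push_cast at h2 ⊢
      linarith
    have h1 := norm_coeff_div_prod_le Finset.univ (by linarith) (by positivity) hb ih i
    refine h1.trans ?_
    rw [Finset.card_univ, Fintype.card_fin, div_le_iff₀ (by positivity)]
    have h2 : r⁻¹ ≤ K ^ d := (le_max_right _ _).trans (le_self_pow₀ hK1 (by omega))
    have h3 : 1 ≤ r * K ^ d := by
      have := mul_le_mul_of_nonneg_left h2 hr.le
      rwa [mul_inv_cancel₀ hr.ne'] at this
    calc C / r ^ n₀ * r ^ n ≤ C / r ^ n₀ * r ^ n * (r * K ^ d) :=
          le_mul_of_one_le_right (by positivity) h3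
      _ = _ := by ring

theorem eval_polyL {α : ℂ} (hα : α ≠ 0) (j k : ℕ) (x : ℂ) : (polyL α j k).eval x =
    (k.factorial : ℂ) * ∑ i ∈ Finset.range j,
      ((Ring.choose ((i : ℤ) - (j : ℤ)) k : ℤ) : ℂ) * α ^ ((i : ℤ) - (j : ℤ) - (k : ℤ)) /
        (i.factorial : ℂ) * (-x) ^ i := by
  rw [polyL, if_neg hα]
  simp [Polynomial.eval_finsetSum]

/-- All exponents of `α` in `L_{α,j,k}` are negative, so the powers are bounded by `1`. -/
theorem exists_norm_eval_polyL_le (j k : ℕ) (x : ℂ) :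
    ∃ C : ℝ, 0 ≤ C ∧ ∀ α : ℂ, 1 ≤ ‖α‖ → ‖(polyL α j k).eval x‖ ≤ C := by
  refine ⟨(k.factorial : ℝ) * ∑ i ∈ Finset.range j,
      ‖((Ring.choose ((i : ℤ) - (j : ℤ)) k : ℤ) : ℂ)‖ * 1 / (i.factorial : ℝ) * ‖-x‖ ^ i,
    by positivity, fun α hα => ?_⟩
  have h0 : α ≠ 0 := fun h => by norm_num [h] at hα
  rw [eval_polyL h0, norm_mul, Complex.norm_natCast]
  refine mul_le_mul_of_nonneg_left (norm_sum_le_of_le _ fun i hi => ?_) (by positivity)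
  rw [norm_mul, norm_div, norm_mul, norm_pow, Complex.norm_natCast, norm_zpow]
  have h1 : ‖α‖ ^ ((i : ℤ) - (j : ℤ) - (k : ℤ)) ≤ 1 :=
    zpow_le_one_of_nonpos₀ hα (by have := Finset.mem_range.1 hi; omega)
  gcongr

theorem seriesTerm_isBigO (hd : 1 ≤ d) (q : HodgeClass lam) (k : ℕ) (s : ℂ) (t : ℝ) {r : ℝ}
    (hr : 0 < r) :
    (fun n : ℕ => seriesTerm lam q k s t (n + 1)) =O[atTop] fun n => r ^ n := by
  set x : ℂ := ((Real.log t : ℝ) : ℂ)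
  choose L hL0 hL using fun j => exists_norm_eval_polyL_le j k x
  -- Chosen so that `ρ^n` absorbs `t^{2n}` and leaves `r^n`.
  set ρ := r / (t ^ 2 + 1) with hρ
  have hρ0 : 0 < ρ := by positivity
  obtain ⟨C, n₀, hC0, hC⟩ := exists_norm_laurentC_coeff_le hd q hρ0
  obtain ⟨n₁, hn₁⟩ := exists_nat_ge (1 + ‖s - basePoint lam q‖)
  refine IsBigO.of_bound (∑ i ∈ Finset.Icc 1 (classSize lam q), C * L i * r) ?_
  filter_upwards [eventually_ge_atTop n₀, eventually_ge_atTop n₁] with n h0 h1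
  have hα : 1 ≤ ‖2 * ((n + 1 : ℕ) : ℂ) + s - basePoint lam q‖ := by
    have h2 := norm_sub_norm_le (2 * ((n + 1 : ℕ) : ℂ)) (-(s - basePoint lam q))
    rw [sub_neg_eq_add, norm_neg, norm_mul, Complex.norm_natCast, ← add_sub_assoc] at h2
    have h3 : (n₁ : ℝ) ≤ n := by exact_mod_cast h1
    have h4 : (0 : ℝ) ≤ n₁ := Nat.cast_nonneg _
    push_cast at h2 ⊢
    rw [Complex.norm_two] at h2
    linarith
  rw [seriesTerm, norm_mul, polyS, Polynomial.eval_finsetSum, norm_pow, Complex.norm_real,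
    Real.norm_of_nonneg (by positivity : (0 : ℝ) ≤ r ^ n)]
  have h2 : ‖∑ i ∈ Finset.Icc 1 (classSize lam q), Polynomial.eval x
      (Polynomial.C (coeffC lam q i (n + 1)) *
        polyL (2 * ((n + 1 : ℕ) : ℂ) + s - basePoint lam q) i k)‖ ≤
      ∑ i ∈ Finset.Icc 1 (classSize lam q), C * ρ ^ (n + 1) * L i := by
    refine norm_sum_le_of_le _ fun i hi => ?_
    rw [Polynomial.eval_mul, Polynomial.eval_C, norm_mul]
    obtain ⟨i, rfl⟩ : ∃ j, i = j + 1 := ⟨i - 1, by have := (Finset.mem_Icc.1 hi).1; omega⟩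
    refine mul_le_mul ?_ (hL _ _ hα) (norm_nonneg _) (by positivity)
    have := hC (n + 1) (by omega) i
    rwa [coeffC, Nat.cast_succ]
  have h3 : (‖t‖ ^ (2 * (n + 1))) ≤ (t ^ 2 + 1) ^ (n + 1) := by
    rw [pow_mul, Real.norm_eq_abs, sq_abs]
    exact pow_le_pow_left₀ (sq_nonneg t) (by linarith) _
  refine (mul_le_mul h2 h3 (by positivity)
    (Finset.sum_nonneg fun i _ => mul_nonneg (by positivity) (hL0 i))).trans_eq ?_
  rw [Finset.sum_mul, Finset.sum_mul]
  refine Finset.sum_congr rfl fun i _ => ?_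
  have h4 : ρ ^ (n + 1) * (t ^ 2 + 1) ^ (n + 1) = r ^ (n + 1) := by
    rw [← mul_pow, hρ, div_mul_cancel₀ _ (by positivity)]
  calc _ = C * L i * (ρ ^ (n + 1) * (t ^ 2 + 1) ^ (n + 1)) := by ring
    _ = _ := by rw [h4]; ring

theorem summable_and_tail_isBigO {u : ℕ → ℂ}
    (hu : ∀ r : ℝ, 0 < r → u =O[atTop] fun n : ℕ => r ^ n) :
    Summable u ∧ ∀ r : ℝ, 0 < r →
      (fun M : ℕ => (∑' n, u n) - ∑ n ∈ Finset.range M, u n) =O[atTop] fun M : ℕ => r ^ M := by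
  have hs : Summable u := summable_of_isBigO_nat
    (summable_geometric_of_lt_one (by norm_num) (by norm_num : (1 / 2 : ℝ) < 1))
    (hu (1 / 2) (by norm_num))
  refine ⟨hs, fun r hr => ?_⟩
  -- The cap at `1/2` keeps the geometric majorant summable when `r ≥ 1`.
  set ρ := min r (1 / 2) with hρ
  have hρ0 : 0 < ρ := lt_min hr (by norm_num)
  have hρ1 : ρ ≤ 1 / 2 := min_le_right _ _
  obtain ⟨C, hC0, hC⟩ := (hu ρ hρ0).exists_nonneg
  obtain ⟨n₀, hn₀⟩ := eventually_atTop.1 hC.bound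
  refine IsBigO.of_bound (C * (1 - ρ)⁻¹) ?_
  filter_upwards [eventually_ge_atTop n₀] with M hM
  rw [← hs.sum_add_tsum_nat_add M, add_sub_cancel_left]
  have h1 : HasSum (fun n : ℕ => C * ρ ^ M * ρ ^ n) (C * ρ ^ M * (1 - ρ)⁻¹) :=
    (hasSum_geometric_of_lt_one hρ0.le (by linarith)).mul_left _
  have h2 := tsum_of_norm_bounded (f := fun n => u (n + M)) h1 fun n => by
    have := hn₀ (n + M) (by omega)
    rw [Real.norm_of_nonneg (by positivity)] at this
    refine this.trans_eq ?_
    ring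
  refine h2.trans ?_
  rw [Real.norm_of_nonneg (by positivity), mul_right_comm]
  have h3 : ρ ^ M ≤ r ^ M := pow_le_pow_left₀ hρ0.le (min_le_left _ _) M
  have h4 : 0 ≤ (1 - ρ)⁻¹ := inv_nonneg.2 (by linarith)
  gcongr

/-! ### The inverse Mellin transform and Mellin inversion -/

theorem integrable_gammaFactor_mul (hd : 1 ≤ d) {σ : ℝ} (hσ : IsRegularLine lam σ) {w : ℂ → ℂ}
    {K : ℝ} (hw : Measurable w) (hK : ∀ y : ℝ, ‖w (σ + y * I)‖ ≤ K) :
    Integrable fun y : ℝ => gammaFactor lam (σ + y * I) * w (σ + y * I) :=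
  (hσ.integrable hd).mul_bdd (c := K) (hw.comp (by fun_prop)).aestronglyMeasurable
    (Eventually.of_forall hK)

/-- The residue theorem in a vertical strip for the product of the Gamma factor with a function
that is bounded near the boundary of the strip. -/
theorem integral_gammaFactor_strip (hd : 1 ≤ d) {ι : Type*} {a b : ℝ} (hab : a ≤ b)
    (ha : IsRegularLine lam a) (hb : IsRegularLine lam b)
    (s : Finset ι) (p r : ι → ℂ) (hinj : Set.InjOn p s) {w : ℂ → ℂ} {K T : ℝ}
    (hw : Measurable w)
    (hres : ∀ i ∈ s, (p i).re ∈ Ioo a b ∧ HasResidue (fun z => gammaFactor lam z * w z) (p i) (r i))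
    (hf : ∀ z : ℂ, z.re ∈ Icc a b → (∀ i ∈ s, z ≠ p i) →
      DifferentiableAt ℂ (fun z => gammaFactor lam z * w z) z)
    (hKa : ∀ y : ℝ, ‖w (a + y * I)‖ ≤ K) (hKb : ∀ y : ℝ, ‖w (b + y * I)‖ ≤ K)
    (hK : ∀ z : ℂ, z.re ∈ Icc a b → T ≤ |z.im| → ‖w z‖ ≤ K) :
    (∫ y : ℝ, gammaFactor lam (b + y * I) * w (b + y * I)) -
      ∫ y : ℝ, gammaFactor lam (a + y * I) * w (a + y * I) = 2 * Real.pi * ∑ i ∈ s, r i := by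
  refine integral_strip_eq_sum_residue hab s p r hinj (fun z => gammaFactor lam z * w z) hres hf
    (integrable_gammaFactor_mul hd ha hw hKa) (integrable_gammaFactor_mul hd hb hw hKb)
    fun ε hε => ?_
  obtain ⟨C, T', hC0, hT', hC⟩ := exists_norm_gammaFactor_le hd lam a b
  have hK0 : 0 ≤ K := (norm_nonneg _).trans (hKa 0)
  refine ⟨max T (max T' (C * K / ε)), fun z hz hi => ?_⟩
  obtain ⟨h1, h2, h3⟩ : T ≤ |z.im| ∧ T' ≤ |z.im| ∧ C * K / ε ≤ |z.im| := by simpa using hi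
  have h4 : 1 ≤ |z.im| := hT'.trans h2
  rw [norm_mul]
  refine (mul_le_mul (hC z hz h2) (hK z hz h1) (norm_nonneg _) (by positivity)).trans ?_
  rw [div_mul_eq_mul_div, div_le_iff₀ (by positivity)]
  rw [div_le_iff₀ hε] at h3
  have h5 : |z.im| ≤ |z.im| ^ 2 := le_self_pow₀ h4 (by norm_num)
  nlinarith

theorem phi_eq_integral (lam : Fin d → ℂ) (σ x : ℝ) :
    phi lam σ x = (1 / (2 * Real.pi) : ℝ) *
      ∫ y : ℝ, gammaFactor lam (σ + y * I) * (x : ℂ) ^ (-(σ + y * I : ℂ)) := by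
  rw [phi, mellinInv, Complex.real_smul]
  simp only [smul_eq_mul, mul_comm]

theorem norm_cpow_neg_le {x : ℝ} (hx : 0 < x) {a b : ℝ} {z : ℂ} (hz : z.re ∈ Icc a b) :
    ‖(x : ℂ) ^ (-z)‖ ≤ max (x ^ (-a)) (x ^ (-b)) := by
  rw [Complex.norm_cpow_eq_rpow_re_of_pos hx, Complex.neg_re]
  rcases le_total 1 x with h | h
  · exact (Real.rpow_le_rpow_of_exponent_le h (neg_le_neg hz.1)).trans (le_max_left _ _)
  · exact (Real.rpow_le_rpow_of_exponent_ge hx h (neg_le_neg hz.2)).trans (le_max_right _ _)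

theorem differentiable_cpow_neg {x : ℝ} (hx : 0 < x) :
    Differentiable ℂ fun z : ℂ => (x : ℂ) ^ (-z) := by
  have hx0 : (x : ℂ) ≠ 0 := by exact_mod_cast hx.ne'
  exact fun z => (differentiableAt_id.neg).const_cpow (Or.inl hx0)

/-- There is no pole between the two lines. The freedom to choose the line gives convergence at `∞`
(line to the right of `Re s`) and at `0` (line to the left). -/
theorem phi_eq_of_le (hd : 1 ≤ d) {σ₁ σ₂ : ℝ} (h : σ₁ ≤ σ₂) (h₁ : ∀ k, -(lam k).re < σ₁) {x : ℝ}
    (hx : 0 < x) : phi lam σ₁ x = phi lam σ₂ x := by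
  have h₂ : ∀ k, -(lam k).re < σ₂ := fun k => (h₁ k).trans_le h
  rw [phi_eq_integral, phi_eq_integral]
  congr 1
  have hK : ∀ z : ℂ, z.re ∈ Icc σ₁ σ₂ →
    ‖(x : ℂ) ^ (-z)‖ ≤ max (x ^ (-σ₁)) (x ^ (-σ₂)) := fun z hz => norm_cpow_neg_le hx hz
  have := integral_gammaFactor_strip hd h (isRegularLine_of_gt h₁) (isRegularLine_of_gt h₂)
    (∅ : Finset ℕ) (fun _ => 0) (fun _ => 0) (by simp) (w := fun z => (x : ℂ) ^ (-z)) (T := 0)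
    (differentiable_cpow_neg hx).continuous.measurable (by simp)
    (fun z hz _ => (isRegular_of_re fun k => (h₁ k).trans_le hz.1).analyticAt.differentiableAt.mul
      (differentiable_cpow_neg hx z))
    (fun y => hK _ (by simpa using h)) (fun y => hK _ (by simpa using h)) (fun z hz _ => hK z hz)
  simp only [Finset.sum_empty, mul_zero] at this
  exact (sub_eq_zero.1 this).symm

theorem phi_eq (hd : 1 ≤ d) {σ₁ σ₂ : ℝ} (h₁ : ∀ k, -(lam k).re < σ₁)
    (h₂ : ∀ k, -(lam k).re < σ₂) {x : ℝ} (hx : 0 < x) : phi lam σ₁ x = phi lam σ₂ x := by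
  rcases le_total σ₁ σ₂ with h | h
  · exact phi_eq_of_le hd h h₁ hx
  · exact (phi_eq_of_le hd h h₂ hx).symm

/-- Fubini for the integral of `φ(x) x^{s-1}` over a set on which `x^{Re s - 1 - σ}` is
integrable. -/
theorem integral_phi_mul_cpow (hd : 1 ≤ d) {σ : ℝ} (hσ : IsRegularLine lam σ) {A : Set ℝ}
    (hA : MeasurableSet A) (hA0 : A ⊆ Ioi 0) (s : ℂ)
    (hint : IntegrableOn (fun x : ℝ => x ^ (s.re - 1 - σ)) A) :
    IntegrableOn (fun x : ℝ => phi lam σ x * (x : ℂ) ^ (s - 1)) A ∧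
    ∫ x in A, phi lam σ x * (x : ℂ) ^ (s - 1) = (1 / (2 * Real.pi) : ℝ) *
      ∫ y : ℝ, gammaFactor lam (σ + y * I) * ∫ x in A, (x : ℂ) ^ (s - 1 - (σ + y * I : ℂ)) := by
  set F : ℝ × ℝ → ℂ := fun q =>
    gammaFactor lam (σ + q.2 * I) * (q.1 : ℂ) ^ (s - 1 - (σ + q.2 * I : ℂ)) with hF
  have hFm : Measurable F :=
    (hσ.continuous.measurable.comp measurable_snd).mul
      (Measurable.pow (by fun_prop) (by fun_prop))
  have hn : ∀ x ∈ A, ∀ y : ℝ, ‖(x : ℂ) ^ (s - 1 - (σ + y * I : ℂ))‖ = x ^ (s.re - 1 - σ) := by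
    intro x hx y
    rw [Complex.norm_cpow_eq_rpow_re_of_pos (hA0 hx)]
    simp
  have hFi : Integrable F ((volume.restrict A).prod volume) := by
    rw [integrable_prod_iff hFm.aestronglyMeasurable]
    constructor
    · refine ae_restrict_of_forall_mem hA fun x hx => ?_
      refine (hσ.integrable hd).mul_bdd (c := x ^ (s.re - 1 - σ)) ?_
        (Eventually.of_forall fun y => (hn x hx y).le)
      exact (Measurable.pow (by fun_prop) (by fun_prop)).aestronglyMeasurable
    · have h1 : IntegrableOn (fun x : ℝ => x ^ (s.re - 1 - σ) *
          ∫ y : ℝ, ‖gammaFactor lam (σ + y * I)‖) A := hint.mul_const _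
      refine h1.congr_fun (fun x hx => ?_) hA
      simp only [hF, norm_mul, hn x hx]
      rw [integral_mul_const, mul_comm]
  have hφ : ∀ x ∈ A, phi lam σ x * (x : ℂ) ^ (s - 1) =
      (1 / (2 * Real.pi) : ℝ) * ∫ y : ℝ, F (x, y) := by
    intro x hx
    rw [phi_eq_integral, mul_assoc, ← integral_mul_const]
    congr 2
    ext y
    have hx0 : (x : ℂ) ≠ 0 := by exact_mod_cast (hA0 hx).ne'
    simp only [hF]
    rw [mul_assoc, ← Complex.cpow_add _ _ hx0]
    congr 2
    ring
  constructor
  · exact (integrableOn_congr_fun hφ hA).2 (hFi.integral_prod_left.const_mul _)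
  · rw [setIntegral_congr_fun hA hφ, integral_const_mul, integral_integral_swap
      (f := fun x y => F (x, y)) hFi]
    simp only [hF, integral_const_mul]

theorem integrableOn_phi_mul_cpow (hd : 1 ≤ d) {c : ℝ} (hc : ∀ j, -(lam j).re < c) {t : ℝ}
    (ht : 0 < t) (s : ℂ) :
    IntegrableOn (fun x : ℝ => phi lam c x * (x : ℂ) ^ (s - 1)) (Ioi t) := by
  obtain ⟨σ, h1, h2⟩ : ∃ σ, (∀ k, -(lam k).re < σ) ∧ s.re < σ :=
    ⟨max c (s.re + 1), fun k => (hc k).trans_le (le_max_left _ _),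
      (lt_add_one _).trans_le (le_max_right _ _)⟩
  refine (integral_phi_mul_cpow hd (isRegularLine_of_gt h1) measurableSet_Ioi
    (Ioi_subset_Ioi ht.le) s (integrableOn_Ioi_rpow_of_lt (by linarith) ht)).1.congr_fun
    (fun x hx => ?_) measurableSet_Ioi
  simp only
  rw [phi_eq hd h1 hc (ht.trans hx)]

/-- `t^s ∫_{Re z = σ} γ(z) t^{-z} / (z - s) dz` computes the incomplete Mellin transform. -/
theorem setIntegral_Ioi_phi (hd : 1 ≤ d) {c σ : ℝ} (hc : ∀ j, -(lam j).re < c)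
    (hσ : ∀ j, -(lam j).re < σ) {t : ℝ} (ht : 0 < t) {s : ℂ} (hs : s.re < σ) :
    ∫ x in Ioi t, phi lam c x * (x : ℂ) ^ (s - 1) = (1 / (2 * Real.pi) : ℝ) * ((t : ℂ) ^ s *
      ∫ y : ℝ, gammaFactor lam (σ + y * I) *
        ((t : ℂ) ^ (-(σ + y * I : ℂ)) * ((σ + y * I : ℂ) - s)⁻¹)) := by
  have h1 := (integral_phi_mul_cpow hd (isRegularLine_of_gt hσ) measurableSet_Ioi
    (Ioi_subset_Ioi ht.le) s (integrableOn_Ioi_rpow_of_lt (by linarith) ht)).2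
  rw [setIntegral_congr_fun (g := fun x : ℝ => phi lam σ x * (x : ℂ) ^ (s - 1))
    measurableSet_Ioi (fun x hx => by simp only; rw [phi_eq hd hc hσ (ht.trans hx)]), h1]
  congr 1
  rw [← integral_const_mul]
  congr 1
  ext y
  have ht0 : (t : ℂ) ≠ 0 := by exact_mod_cast ht.ne'
  have hne : (σ + y * I : ℂ) - s ≠ 0 := fun h => by
    have := congrArg Complex.re h
    simp at this
    linarith
  rw [integral_Ioi_cpow_of_lt (by simp; linarith) ht,
    show s - 1 - (σ + y * I : ℂ) + 1 = s + -(σ + y * I) by ring, Complex.cpow_add _ _ ht0]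
  have hne' : s + -(σ + y * I : ℂ) ≠ 0 := fun h => hne (by linear_combination -h)
  field_simp
  ring

theorem integrableOn_Ioc_phi (hd : 1 ≤ d) {c : ℝ} (hc : ∀ j, -(lam j).re < c) {s : ℂ}
    (hs : c < s.re) :
    IntegrableOn (fun x : ℝ => phi lam c x * (x : ℂ) ^ (s - 1)) (Ioc 0 1) ∧
    ∫ x in Ioc 0 1, phi lam c x * (x : ℂ) ^ (s - 1) = -((1 / (2 * Real.pi) : ℝ) *
      ∫ y : ℝ, gammaFactor lam (c + y * I) * ((c + y * I : ℂ) - s)⁻¹) := by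
  have hint : IntegrableOn (fun x : ℝ => x ^ (s.re - 1 - c)) (Ioc 0 1) := by
    rw [← intervalIntegrable_iff_integrableOn_Ioc_of_le zero_le_one]
    exact intervalIntegral.intervalIntegrable_rpow' (by linarith)
  obtain ⟨h1, h2⟩ := integral_phi_mul_cpow hd (isRegularLine_of_gt hc) measurableSet_Ioc
    Ioc_subset_Ioi_self s hint
  refine ⟨h1, ?_⟩
  rw [h2, ← mul_neg, ← integral_neg]
  congr 2
  ext y
  have hne : s - 1 - (c + y * I : ℂ) + 1 ≠ 0 := fun h => by
    have := congrArg Complex.re h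
    simp at this
    linarith
  rw [← intervalIntegral.integral_of_le zero_le_one, integral_cpow (Or.inl (by simp; linarith)),
    Complex.ofReal_one, Complex.one_cpow, Complex.ofReal_zero, Complex.zero_cpow hne, sub_zero,
    ← mul_neg, ← inv_neg, one_div]
  congr 2
  ring

theorem integral_gammaFactor_div_sub (hd : 1 ≤ d) {a b : ℝ} (ha : ∀ j, -(lam j).re < a) {s : ℂ}
    (has : a < s.re) (hsb : s.re < b) :
    (∫ y : ℝ, gammaFactor lam (b + y * I) * ((b + y * I : ℂ) - s)⁻¹) -
      ∫ y : ℝ, gammaFactor lam (a + y * I) * ((a + y * I : ℂ) - s)⁻¹ =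
        2 * Real.pi * gammaFactor lam s := by
  have hb : ∀ j, -(lam j).re < b := fun j => (ha j).trans (has.trans hsb)
  have hre : ∀ z : ℂ, ∀ δ : ℝ, 0 < δ → δ ≤ |(z - s).re| → ‖(z - s)⁻¹‖ ≤ δ⁻¹ := fun z δ hδ h => by
    rw [norm_inv]
    exact inv_anti₀ hδ (h.trans (Complex.abs_re_le_norm _))
  have him : ∀ z : ℂ, ∀ δ : ℝ, 0 < δ → δ ≤ |(z - s).im| → ‖(z - s)⁻¹‖ ≤ δ⁻¹ := fun z δ hδ h => by
    rw [norm_inv]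
    exact inv_anti₀ hδ (h.trans (Complex.abs_im_le_norm _))
  set δ := min (s.re - a) (b - s.re) with hδ
  have hδ0 : 0 < δ := lt_min (by linarith) (by linarith)
  have hγ : ∀ z : ℂ, a ≤ z.re → AnalyticAt ℂ (gammaFactor lam) z := fun z hz =>
    (isRegular_of_re fun k => (ha k).trans_le hz).analyticAt
  have h1 := integral_gammaFactor_strip hd (has.trans hsb).le (isRegularLine_of_gt ha)
    (isRegularLine_of_gt hb) ({0} : Finset ℕ) (fun _ => s) (fun _ => gammaFactor lam s)
    (by simp) (w := fun z => (z - s)⁻¹) (K := δ⁻¹) (T := δ + |s.im|)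
    (by fun_prop) (fun _ _ => ⟨⟨has, hsb⟩, ?_⟩) (fun z hz hzs => ?_)
    (fun y => hre _ δ hδ0 ?_) (fun y => hre _ δ hδ0 ?_) (fun z hz hi => him z δ hδ0 ?_)
  · simpa using h1
  · have := hasResidue_mul_inv_pow (hγ s has.le) 0
    simpa [mul_comm] using this
  · refine (hγ z hz.1).differentiableAt.mul ?_
    have : z - s ≠ 0 := sub_ne_zero.2 (hzs 0 (by simp))
    fun_prop (disch := assumption)
  · have h : ((a + y * I : ℂ) - s).re = -(s.re - a) := by simp
    rw [h, abs_neg, abs_of_pos (by linarith)]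
    exact min_le_left _ _
  · have h : ((b + y * I : ℂ) - s).re = b - s.re := by simp
    rw [h, abs_of_pos (by linarith)]
    exact min_le_right _ _
  · rw [Complex.sub_im]
    have := abs_sub_abs_le_abs_sub z.im s.im
    linarith

/-- Split the integral at `1`, using a line to the left of `Re z` on `(0, 1]` and one to the right
on `(1, ∞)`. The two pieces combine into a difference of line integrals of `γ(w) / (w - z)`, whose
only enclosed residue is `γ(z)`. -/
theorem mellin_phi (hd : 1 ≤ d) {c : ℝ} (hc : ∀ j, -(lam j).re < c) {z : ℂ}
    (hz : ∀ j, -(lam j).re < z.re) :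
    MellinConvergent (phi lam c) z ∧ mellin (phi lam c) z = gammaFactor lam z := by
  obtain ⟨a, ha, haz⟩ : ∃ a, (∀ k, -(lam k).re < a) ∧ a < z.re := by
    have h1 : ∀ᶠ a in 𝓝[<] z.re, ∀ k, -(lam k).re < a := by
      rw [eventually_all]
      exact fun k => nhdsWithin_le_nhds (lt_mem_nhds (hz k))
    obtain ⟨a, h2, h3⟩ := (h1.and self_mem_nhdsWithin).exists
    exact ⟨a, h2, h3⟩
  obtain ⟨i1, e1⟩ := integrableOn_Ioc_phi hd ha haz
  have hb : ∀ j, -(lam j).re < z.re + 1 := fun j => (hz j).trans (lt_add_one _)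
  have e2 := setIntegral_Ioi_phi hd ha hb one_pos (lt_add_one z.re)
  have i2 := integrableOn_phi_mul_cpow hd ha one_pos z
  have e3 := integral_gammaFactor_div_sub hd ha haz (lt_add_one z.re)
  have hu : Ioc (0 : ℝ) 1 ∪ Ioi 1 = Ioi 0 := Ioc_union_Ioi_eq_Ioi zero_le_one
  have hcongr : EqOn (fun x : ℝ => (x : ℂ) ^ (z - 1) • phi lam c x)
      (fun x : ℝ => phi lam a x * (x : ℂ) ^ (z - 1)) (Ioi 0) := fun x hx => by
    simp only
    rw [smul_eq_mul, mul_comm, phi_eq hd hc ha hx]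
  constructor
  · rw [MellinConvergent, integrableOn_congr_fun hcongr measurableSet_Ioi, ← hu]
    exact i1.union i2
  · rw [mellin, setIntegral_congr_fun measurableSet_Ioi hcongr, ← hu,
      setIntegral_union (Ioc_disjoint_Ioi le_rfl) measurableSet_Ioi i1 i2, e1, e2]
    simp only [Complex.ofReal_one, Complex.one_cpow, one_mul]
    rw [← sub_eq_neg_add, ← mul_sub, e3, ← mul_assoc]
    have : ((1 / (2 * Real.pi) : ℝ) : ℂ) * (2 * Real.pi) = 1 := by
      have := Real.pi_ne_zero
      push_cast
      field_simp
    rw [this, one_mul]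

/-! ### The contour integral for `G_s(t)` and its derivatives in `s` -/

/-- The kernel `t^{-z} / (z - s)^{k+1}`. -/
def kernel (t : ℝ) (s : ℂ) (k : ℕ) (z : ℂ) : ℂ := (t : ℂ) ^ (-z) * ((z - s) ^ (k + 1))⁻¹

theorem measurable_kernel {t : ℝ} (ht : 0 < t) (s : ℂ) (k : ℕ) : Measurable (kernel t s k) := by
  have := (differentiable_cpow_neg ht).continuous.measurable
  unfold kernel
  fun_prop

theorem norm_kernel_le {t : ℝ} (ht : 0 < t) {s : ℂ} (k : ℕ) {δ : ℝ} (hδ : 0 < δ) {z : ℂ}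
    (hz : δ ≤ ‖z - s‖) : ‖kernel t s k z‖ ≤ t ^ (-z.re) * (δ ^ (k + 1))⁻¹ := by
  rw [kernel, norm_mul, Complex.norm_cpow_eq_rpow_re_of_pos ht, norm_inv, norm_pow, Complex.neg_re]
  gcongr

theorem hasDerivAt_kernel (t : ℝ) (k : ℕ) {s z : ℂ} (hz : z - s ≠ 0) :
    HasDerivAt (fun s => kernel t s k z) ((k + 1 : ℕ) * kernel t s (k + 1) z) s := by
  have h1 : HasDerivAt (fun s => (z - s) ^ (k + 1))
      (((k + 1 : ℕ) : ℂ) * (z - s) ^ (k + 1 - 1) * -1) s :=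
    ((hasDerivAt_id s).const_sub z).pow (k + 1)
  refine ((h1.inv (pow_ne_zero _ hz)).const_mul ((t : ℂ) ^ (-z))).congr_deriv ?_
  simp only [kernel, Nat.add_sub_cancel]
  field_simp
  ring

/-- `∫_{Re z = σ} γ(z) t^{-z} / (z - s)^{k+1}`, up to the factor `i`. -/
def lineIntegral (lam : Fin d → ℂ) (σ t : ℝ) (s : ℂ) (k : ℕ) : ℂ :=
  ∫ y : ℝ, gammaFactor lam (σ + y * I) * kernel t s k (σ + y * I)

theorem le_norm_line_sub (σ y : ℝ) (s : ℂ) : |σ - s.re| ≤ ‖(σ + y * I : ℂ) - s‖ := by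
  simpa using Complex.abs_re_le_norm ((σ + y * I : ℂ) - s)

theorem norm_kernel_line_le {t : ℝ} (ht : 0 < t) {s : ℂ} (k : ℕ) {δ : ℝ} (hδ : 0 < δ) {σ : ℝ}
    (h : δ ≤ |σ - s.re|) (y : ℝ) :
    ‖kernel t s k (σ + y * I)‖ ≤ t ^ (-σ) * (δ ^ (k + 1))⁻¹ := by
  simpa using norm_kernel_le ht k hδ (h.trans (le_norm_line_sub σ y s))

theorem hasDerivAt_lineIntegral (hd : 1 ≤ d) {σ : ℝ} (hσ : IsRegularLine lam σ) {t : ℝ}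
    (ht : 0 < t) {s : ℂ} (hs : s.re < σ) (k : ℕ) :
    HasDerivAt (fun s => lineIntegral lam σ t s k)
      ((k + 1 : ℕ) * lineIntegral lam σ t s (k + 1)) s := by
  -- Half the distance to the line: points of the `δ`-ball around `s` stay at distance at least `δ`
  -- from it, which gives a uniform dominating function.
  set δ := (σ - s.re) / 2 with hδ
  have hδ0 : 0 < δ := by rw [hδ]; linarith
  have hball : ∀ x ∈ Metric.ball s δ, δ ≤ |σ - x.re| := by
    intro x hx
    rw [Metric.mem_ball, dist_eq_norm] at hx
    have h1 := (Complex.abs_re_le_norm (x - s)).trans_lt hx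
    rw [Complex.sub_re] at h1
    have h2 := (abs_lt.1 h1).2
    refine le_trans ?_ (le_abs_self _)
    linarith
  have hint : ∀ k, ∀ x ∈ Metric.ball s δ,
      Integrable fun y : ℝ => gammaFactor lam (σ + y * I) * kernel t x k (σ + y * I) :=
    fun k x hx => integrable_gammaFactor_mul hd hσ (measurable_kernel ht x k)
      (norm_kernel_line_le ht k hδ0 (hball x hx))
  have key := hasDerivAt_integral_of_dominated_loc_of_deriv_le
    (μ := volume) (F := fun s (y : ℝ) => gammaFactor lam (σ + y * I) * kernel t s k (σ + y * I))
    (F' := fun s (y : ℝ) => gammaFactor lam (σ + y * I) *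
      ((k + 1 : ℕ) * kernel t s (k + 1) (σ + y * I)))
    (bound := fun y : ℝ => ‖gammaFactor lam (σ + y * I)‖ *
      ((k + 1 : ℕ) * (t ^ (-σ) * (δ ^ (k + 1 + 1))⁻¹)))
    (x₀ := s) (Metric.ball_mem_nhds s hδ0) ?_ (hint k s (Metric.mem_ball_self hδ0)) ?_ ?_ ?_ ?_
  · refine key.2.congr_deriv ?_
    rw [lineIntegral, ← integral_const_mul]
    congr 1
    ext y
    ring
  · filter_upwards [Metric.ball_mem_nhds s hδ0] with x hx
    exact (hint k x hx).aestronglyMeasurable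
  · have := ((hint (k + 1) s (Metric.mem_ball_self hδ0)).const_mul ((k + 1 : ℕ) : ℂ))
    refine this.aestronglyMeasurable.congr (Eventually.of_forall fun y => ?_)
    simp only
    ring
  · refine Eventually.of_forall fun y x hx => ?_
    rw [norm_mul, norm_mul, Complex.norm_natCast]
    have := norm_kernel_line_le ht (k + 1) hδ0 (hball x hx) y
    gcongr
  · exact (hσ.integrable hd).norm.mul_const _
  · refine Eventually.of_forall fun y x hx => (hasDerivAt_kernel t k ?_).const_mul _
    intro h
    have := (hball x hx).trans (le_norm_line_sub σ y x)
    rw [h, norm_zero] at this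
    linarith

theorem incompleteMellin_eq (hd : 1 ≤ d) {c σ : ℝ} (hc : ∀ j, -(lam j).re < c)
    (hσ : ∀ j, -(lam j).re < σ) {t : ℝ} (ht : 0 < t) {s : ℂ} (hs : s.re < σ) :
    incompleteMellin lam c s t = (1 / (2 * Real.pi) : ℝ) * lineIntegral lam σ t s 0 := by
  have ht0 : (t : ℂ) ≠ 0 := by exact_mod_cast ht.ne'
  rw [incompleteMellin, setIntegral_Ioi_phi hd hc hσ ht hs, mul_left_comm, ← mul_assoc ((t : ℂ) ^ _),
    ← Complex.cpow_add _ _ ht0, neg_add_cancel, Complex.cpow_zero, one_mul]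
  simp only [lineIntegral, kernel, zero_add, pow_one]

theorem iteratedDeriv_incompleteMellin (hd : 1 ≤ d) {c σ : ℝ} (hc : ∀ j, -(lam j).re < c)
    (hσ : ∀ j, -(lam j).re < σ) {t : ℝ} (ht : 0 < t) (k : ℕ) : ∀ {s : ℂ}, s.re < σ →
    iteratedDeriv k (fun S => incompleteMellin lam c S t) s =
      (1 / (2 * Real.pi) : ℝ) * (k.factorial * lineIntegral lam σ t s k) := by
  induction k with
  | zero =>
    intro s hs
    simp [incompleteMellin_eq hd hc hσ ht hs]
  | succ k ih =>
    intro s hs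
    rw [iteratedDeriv_succ]
    -- The formula holds on the open half-plane `Re s < σ`, with `σ` fixed, and may therefore be
    -- differentiated.
    have h1 : iteratedDeriv k (fun S => incompleteMellin lam c S t) =ᶠ[𝓝 s] fun s =>
        (1 / (2 * Real.pi) : ℝ) * (k.factorial * lineIntegral lam σ t s k) := by
      filter_upwards [(isOpen_lt Complex.continuous_re continuous_const).mem_nhds hs] with x hx
      exact ih hx
    rw [h1.deriv_eq, (((hasDerivAt_lineIntegral hd (isRegularLine_of_gt hσ) ht hs k).const_mul
      ((k.factorial : ℕ) : ℂ)).const_mul _).deriv, Nat.factorial_succ]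
    push_cast
    ring

theorem differentiable_incompleteMellin (hd : 1 ≤ d) {c : ℝ} (hc : ∀ j, -(lam j).re < c)
    {t : ℝ} (ht : 0 < t) : Differentiable ℂ fun s => incompleteMellin lam c s t := by
  intro s
  obtain ⟨σ, h1, h2⟩ : ∃ σ, (∀ k, -(lam k).re < σ) ∧ s.re < σ :=
    ⟨max c (s.re + 1), fun k => (hc k).trans_le (le_max_left _ _),
      (lt_add_one _).trans_le (le_max_right _ _)⟩
  refine DifferentiableAt.congr_of_eventuallyEq (f := fun s =>
    (1 / (2 * Real.pi) : ℝ) * lineIntegral lam σ t s 0) ?_ ?_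
  · exact ((hasDerivAt_lineIntegral hd (isRegularLine_of_gt h1) ht h2 0).const_mul
      _).differentiableAt
  · filter_upwards [(isOpen_lt Complex.continuous_re continuous_const).mem_nhds h2] with x hx
    exact incompleteMellin_eq hd hc h1 ht hx

/-! ### Residues of the Gamma factor times the kernel -/

theorem prod_neg_sub_eq (k n : ℕ) : ∏ i ∈ Finset.range n, (-((k + 1 : ℕ) : ℂ) - i) =
    (-1) ^ n * (n.factorial * (n + k).choose k) := by
  induction n with
  | zero => simp
  | succ n ih =>
    have h := Nat.add_one_mul_choose_eq (n + k) n
    rw [Nat.choose_symm_add, show n + k + 1 = n + 1 + k by ring, Nat.choose_symm_add] at h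
    have h' : (((n + 1 + k : ℕ) : ℂ)) * ((n + k).choose k : ℂ) =
        ((n + 1 + k).choose k : ℂ) * ((n + 1 : ℕ) : ℂ) := by exact_mod_cast h
    rw [Finset.prod_range_succ, ih, Nat.factorial_succ, pow_succ]
    push_cast at h' ⊢
    linear_combination (-(-1) ^ n * (n.factorial : ℂ)) * h'

theorem iteratedDeriv_inv_sub_pow (s p : ℂ) (k n : ℕ) :
    iteratedDeriv n (fun z : ℂ => ((z - s) ^ (k + 1))⁻¹) p =
      (-1) ^ n * (n.factorial * (n + k).choose k) * ((p - s) ^ (n + k + 1))⁻¹ := by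
  have h1 : (fun z : ℂ => ((z - s) ^ (k + 1))⁻¹) =
      fun z => (fun w : ℂ => w ^ (-((k + 1 : ℕ) : ℤ))) (z - s) := by
    ext z
    simp only
    rw [zpow_neg, zpow_natCast]
  rw [h1, congrFun (iteratedDeriv_comp_sub_const n (fun w : ℂ => w ^ (-((k + 1 : ℕ) : ℤ))) s) p,
    iteratedDeriv_eq_iterate, iter_deriv_zpow, ← prod_neg_sub_eq,
    show -((k + 1 : ℕ) : ℤ) - (n : ℤ) = -((n + k + 1 : ℕ) : ℤ) by push_cast; ring, zpow_neg,
    zpow_natCast]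
  congr 1
  push_cast
  rfl

theorem iteratedDeriv_cpow_neg {t : ℝ} (ht : 0 < t) (p : ℂ) (n : ℕ) :
    iteratedDeriv n (fun z : ℂ => (t : ℂ) ^ (-z)) p =
      (-((Real.log t : ℝ) : ℂ)) ^ n * (t : ℂ) ^ (-p) := by
  have ht0 : (t : ℂ) ≠ 0 := by exact_mod_cast ht.ne'
  have h1 : ∀ z : ℂ, (t : ℂ) ^ (-z) = Complex.exp (-((Real.log t : ℝ) : ℂ) * z) := fun z => by
    rw [Complex.cpow_def_of_ne_zero ht0, Complex.ofReal_log ht.le]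
    congr 1
    ring
  simp only [h1]
  rw [iteratedDeriv_cexp_const_mul]

theorem ring_choose_neg_succ (n k : ℕ) :
    Ring.choose (-((n + 1 : ℕ) : ℤ)) k = (-1) ^ k * ((n + k).choose k : ℤ) := by
  rw [Ring.choose_neg, show ((n + 1 : ℕ) : ℤ) + (k : ℤ) - 1 = ((n + k : ℕ) : ℤ) by
    push_cast; ring, Ring.choose_natCast, Units.smul_def, Int.coe_negOnePow_natCast, smul_eq_mul]

theorem analyticAt_kernel {t : ℝ} (ht : 0 < t) {s z : ℂ} (k : ℕ) (hz : z ≠ s) :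
    AnalyticAt ℂ (kernel t s k) z := by
  have h1 : (z - s) ^ (k + 1) ≠ 0 := pow_ne_zero _ (sub_ne_zero.2 hz)
  have h2 : AnalyticAt ℂ (fun z : ℂ => ((z - s) ^ (k + 1))⁻¹) z := by
    fun_prop (disch := assumption)
  exact ((differentiable_cpow_neg ht).analyticAt z).mul h2

/-- Leibniz' rule: `a` derivatives on `t^{-z}` give `(-ln t)^a`, the other `n = i - a` fall on `(z -
s)^{-(k+1)}` and give `binom(n+k, k)`, which is `(-1)^k binom(a-i-1, k)`. The signs `(-1)^n` and
`(-1)^{n+k+1}`, the latter from `p - s = -(s - p)`, leave the overall minus. -/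
theorem factorial_mul_iteratedDeriv_kernel {t : ℝ} (ht : 0 < t) {s p : ℂ} (hp : p ≠ s) (k i : ℕ) :
    (k.factorial : ℂ) * (iteratedDeriv i (kernel t s k) p / (i.factorial : ℂ)) =
      -((t : ℂ) ^ (-p) * (polyL (s - p) (i + 1) k).eval ((Real.log t : ℝ) : ℂ)) := by
  have hα : s - p ≠ 0 := sub_ne_zero.2 hp.symm
  have h1 : (p - s) ^ (k + 1) ≠ 0 := pow_ne_zero _ (sub_ne_zero.2 hp)
  have h2 : AnalyticAt ℂ (fun z : ℂ => ((z - s) ^ (k + 1))⁻¹) p := by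
    fun_prop (disch := assumption)
  have h3 : kernel t s k = (fun z : ℂ => (t : ℂ) ^ (-z)) * fun z => ((z - s) ^ (k + 1))⁻¹ := rfl
  rw [h3, iteratedDeriv_mul ((differentiable_cpow_neg ht).analyticAt p).contDiffAt h2.contDiffAt,
    eval_polyL hα, mul_left_comm, ← mul_neg, Finset.sum_div, Finset.mul_sum, Finset.mul_sum,
    ← Finset.sum_neg_distrib, Finset.mul_sum]
  refine Finset.sum_congr rfl fun a ha => ?_
  obtain ⟨n, rfl⟩ : ∃ n, i = a + n := ⟨i - a, by have := Finset.mem_range.1 ha; omega⟩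
  rw [iteratedDeriv_cpow_neg ht, iteratedDeriv_inv_sub_pow, Nat.add_sub_cancel_left,
    show (a : ℤ) - ((a + n + 1 : ℕ) : ℤ) = -((n + 1 : ℕ) : ℤ) by push_cast; ring,
    ring_choose_neg_succ, show -((n + 1 : ℕ) : ℤ) - (k : ℤ) = -((n + k + 1 : ℕ) : ℤ) by
      push_cast; ring, zpow_neg, zpow_natCast, show p - s = -1 * (s - p) by ring, mul_pow]
  have h4 : ((a + n).choose a : ℂ) * a.factorial * n.factorial = (a + n).factorial := by
    have := Nat.choose_mul_factorial_mul_factorial (Nat.le_add_right a n)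
    rw [Nat.add_sub_cancel_left] at this
    exact_mod_cast this
  have h5 : ((-1 : ℂ) ^ (n + k + 1))⁻¹ = -((-1) ^ n * (-1) ^ k) := by
    rw [← inv_pow, show (-1 : ℂ)⁻¹ = -1 by norm_num, pow_succ, pow_add]
    ring
  have h6 : ((-1 : ℂ) ^ n) * (-1) ^ n = 1 := by rw [← mul_pow]; norm_num
  have h7 : (a.factorial : ℂ) ≠ 0 := by exact_mod_cast a.factorial_ne_zero
  have h8 : ((a + n).factorial : ℂ) ≠ 0 := by exact_mod_cast (a + n).factorial_ne_zero
  rw [mul_inv, h5, ← h4]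
  rw [← h4] at h8
  have h9 := left_ne_zero_of_mul (left_ne_zero_of_mul h8)
  have h10 := right_ne_zero_of_mul h8
  generalize ((a + n).choose a : ℂ) = u at *
  generalize ((s - p) ^ (n + k + 1))⁻¹ = v
  generalize (t : ℂ) ^ (-p) = w
  generalize ((-1 : ℂ) ^ n) = e at *
  push_cast
  field_simp
  linear_combination (-(k.factorial : ℂ) * (-((Real.log t : ℝ) : ℂ)) ^ a * w *
    ((n + k).choose k : ℂ) * v) * h6

theorem hasResidue_gammaFactor_mul_kernel {t : ℝ} (ht : 0 < t) {s : ℂ} (k : ℕ)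
    (q : HodgeClass lam) (n : ℕ) (hp : basePoint lam q - 2 * (n : ℂ) ≠ s) :
    HasResidue (fun z => gammaFactor lam z * kernel t s k z) (basePoint lam q - 2 * (n : ℂ))
      (-((t : ℂ) ^ (-basePoint lam q) * seriesTerm lam q k s t n) / (k.factorial : ℂ)) := by
  obtain ⟨h, hh⟩ := hasPrincipalPart_gammaFactor q n
  have h1 := hh.hasResidue_mul (analyticAt_kernel ht k hp)
  have hk : (k.factorial : ℂ) ≠ 0 := by exact_mod_cast k.factorial_ne_zero
  have ht0 : (t : ℂ) ≠ 0 := by exact_mod_cast ht.ne'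
  convert h1 using 1
  rw [div_eq_iff hk, Finset.sum_mul]
  have h2 : (t : ℂ) ^ (-(basePoint lam q - 2 * (n : ℂ))) =
      (t : ℂ) ^ (-basePoint lam q) * (t : ℂ) ^ (2 * n) := by
    rw [← Complex.cpow_natCast, ← Complex.cpow_add _ _ ht0]
    congr 1
    push_cast
    ring
  have h3 : s - (basePoint lam q - 2 * (n : ℂ)) = 2 * (n : ℂ) + s - basePoint lam q := by ring
  rw [seriesTerm, polyS, Polynomial.eval_finsetSum,
    show Finset.Icc 1 (classSize lam q) = Finset.Ico 1 (classSize lam q + 1) from rfl,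
    Finset.sum_Ico_eq_sum_range, Nat.add_sub_cancel, Finset.sum_mul, Finset.mul_sum,
    ← Finset.sum_neg_distrib]
  refine Finset.sum_congr rfl fun i _ => ?_
  have h4 := factorial_mul_iteratedDeriv_kernel ht hp k i
  rw [h2, h3] at h4
  rw [Polynomial.eval_mul, Polynomial.eval_C, add_comm 1 i]
  linear_combination -coeffC lam q (i + 1) n * h4

/-- This is where `L_0 = 0` matters: a pole located at `s` contributes only through the Laurent
constant term. -/
theorem seriesTerm_eq_zero {q : HodgeClass lam} {k n : ℕ} {s : ℂ} (t : ℝ)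
    (h : basePoint lam q - 2 * (n : ℂ) = s) : seriesTerm lam q k s t n = 0 := by
  have h1 : 2 * (n : ℂ) + s - basePoint lam q = 0 := by rw [← h]; ring
  rw [seriesTerm, polyS, h1]
  simp [polyL]

theorem exists_hasPrincipalPart_gammaFactor (lam : Fin d → ℂ) (s : ℂ) :
    ∃ N a h, HasPrincipalPart (gammaFactor lam) s N a h := by
  by_cases hs : IsRegular lam s
  · exact ⟨0, 0, gammaFactor lam, hs.analyticAt, by simp⟩
  · simp only [IsRegular, not_forall, not_not] at hs
    obtain ⟨k, m, rfl⟩ := hs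
    obtain ⟨q, n, hqn⟩ := exists_pole_eq (lam := lam) k m
    rw [hqn]
    obtain ⟨h, hh⟩ := hasPrincipalPart_gammaFactor q (n + 1)
    exact ⟨_, _, h, hh⟩

/-- The constant term of the Laurent expansion of `(γ(S) t^{-S})^{(k)}` at `s` is the residue of
`k! γ(z) t^{-z} / (z - s)^{k+1}` at `s`. -/
theorem exists_isLaurentExpansion_hasResidue (lam : Fin d → ℂ) {t : ℝ} (ht : 0 < t) (s : ℂ)
    (k : ℕ) : ∃ a : ℤ → ℂ, IsLaurentExpansion
      (iteratedDeriv k (fun S : ℂ => gammaFactor lam S * (t : ℂ) ^ (-S))) s a ∧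
      HasResidue (fun z => gammaFactor lam z * kernel t s k z) s (a 0 / (k.factorial : ℂ)) := by
  obtain ⟨N, b, h, hh⟩ := exists_hasPrincipalPart_gammaFactor lam s
  obtain ⟨b', h', hh'⟩ := hh.mul_analytic ((differentiable_cpow_neg ht).analyticAt s)
  obtain ⟨M, b'', hd⟩ := hasPrincipalPart_iteratedDeriv hh' k
  obtain ⟨a, ha, ha0⟩ := hd.exists_isLaurentExpansion
  refine ⟨a, ha, ?_⟩
  rw [ha0]
  refine (hh'.hasResidue_mul_inv_pow k).congr (Eventually.of_forall fun z => ?_)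
  simp only [kernel]
  ring

/-! ### Shifting the contour to the left -/

/-- The forbidden abscissas form a countable set, so one `σ` avoids the poles for all shifts by `2n`
at once. -/
theorem exists_isRegularLine (lam : Fin d → ℂ) :
    ∃ σ : ℝ, ∀ n : ℕ, IsRegularLine lam (σ - 2 * n) := by
  have hcount : (⋃ x : Fin d × ℕ × ℕ, {-(lam x.1).re - 2 * (x.2.1 : ℝ) + 2 * (x.2.2 : ℝ)}).Countable :=
    countable_iUnion fun _ => countable_singleton _
  obtain ⟨σ, hσ⟩ := (hcount.dense_compl ℝ).nonempty
  refine ⟨σ, fun n y k m h => hσ (mem_iUnion.2 ⟨(k, m, n), ?_⟩)⟩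
  have := congrArg Complex.re h
  simp at this
  rw [mem_singleton_iff]
  linarith

theorem lineIntegral_sub_lineIntegral (hd : 1 ≤ d) {σ a : ℝ} (hσ : ∀ j, -(lam j).re < σ)
    (ha : IsRegularLine lam a) {t : ℝ} (ht : 0 < t) {s : ℂ} (has : a < s.re) (hsσ : s.re < σ)
    (k : ℕ) {r : ℂ} (hr : HasResidue (fun z => gammaFactor lam z * kernel t s k z) s r) :
    lineIntegral lam σ t s k - lineIntegral lam a t s k = 2 * Real.pi * (r +
      ∑ q : HodgeClass lam, ∑ n ∈ Finset.range ⌈((basePoint lam q).re - a) / 2 - 1⌉₊,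
        -((t : ℂ) ^ (-basePoint lam q) * seriesTerm lam q k s t (n + 1)) /
          (k.factorial : ℂ)) := by
  classical
  set P : (_ : HodgeClass lam) × ℕ → ℂ := fun x => basePoint lam x.1 - 2 * ((x.2 + 1 : ℕ) : ℂ)
  set R : (_ : HodgeClass lam) × ℕ → ℂ := fun x =>
    -((t : ℂ) ^ (-basePoint lam x.1) * seriesTerm lam x.1 k s t (x.2 + 1)) / (k.factorial : ℂ)
  set S : Finset ((_ : HodgeClass lam) × ℕ) := Finset.univ.sigma fun q =>
    Finset.range ⌈((basePoint lam q).re - a) / 2 - 1⌉₊ with hS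
  have hPre : ∀ x, (P x).re = (basePoint lam x.1).re - 2 * (x.2 + 1) := fun x => by simp [P]
  -- The ceiling is chosen so that `S` consists exactly of the poles to the right of `Re z = a`.
  have hmem : ∀ x, x ∈ S ↔ a < (P x).re := fun x => by
    rw [hS, Finset.mem_sigma, Finset.mem_range, Nat.lt_ceil, hPre]
    simp only [Finset.mem_univ, true_and]
    constructor <;> intro h <;> linarith
  have hPσ : ∀ x, (P x).re < σ := fun x => by
    obtain ⟨i, -, hb, -⟩ := exists_basePoint_eq lam x.1
    have := hσ i
    rw [hPre, hb]
    simp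
    linarith [(Nat.cast_nonneg x.2 : (0 : ℝ) ≤ x.2)]
  have hPinj : Function.Injective P := fun x y hxy => by
    have := @basePoint_sub_injective d lam (x.1, x.2) (y.1, y.2) hxy
    rw [Prod.mk.injEq] at this
    exact Sigma.ext this.1 (heq_of_eq this.2)
  have hsum : ∑ x ∈ S.filter (fun x => P x ≠ s), R x = ∑ q : HodgeClass lam,
      ∑ n ∈ Finset.range ⌈((basePoint lam q).re - a) / 2 - 1⌉₊, R ⟨q, n⟩ := by
    rw [Finset.sum_filter_of_ne, hS, Finset.sum_sigma]
    intro x _ hx hP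
    refine hx ?_
    simp only [R]
    rw [seriesTerm_eq_zero t hP]
    simp
  -- The index `none` stands for the point `s`, with residue `r`; a pole equal to `s` has been
  -- filtered out, at no cost since its term is zero.
  have hsum' : ∑ i ∈ Finset.insertNone (S.filter fun x => P x ≠ s), i.elim r R =
      r + ∑ x ∈ S.filter (fun x => P x ≠ s), R x := by
    rw [Finset.sum_insertNone]
    rfl
  rw [← hsum, ← hsum']
  set δ := min (s.re - a) (σ - s.re) with hδ
  have hδ0 : 0 < δ := lt_min (by linarith) (by linarith)
  have hK : ∀ z : ℂ, z.re ∈ Icc a σ → δ ≤ ‖z - s‖ →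
      ‖kernel t s k z‖ ≤ max (t ^ (-a)) (t ^ (-σ)) * (δ ^ (k + 1))⁻¹ := fun z hz h => by
    refine (norm_kernel_le ht k hδ0 h).trans ?_
    have h1 := norm_cpow_neg_le ht hz
    rw [Complex.norm_cpow_eq_rpow_re_of_pos ht, Complex.neg_re] at h1
    gcongr
  have haσ : a ≤ σ := (has.trans hsσ).le
  refine integral_gammaFactor_strip hd haσ ha (isRegularLine_of_gt hσ)
    (Finset.insertNone (S.filter fun x => P x ≠ s)) (fun i => i.elim s P) _ ?_
    (T := δ + |s.im|) (measurable_kernel ht s k) ?_ ?_ (fun y => hK _ (by simpa using haσ) ?_)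
    (fun y => hK _ (by simpa using haσ) ?_) (fun z hz hi => hK z hz ?_)
  · rintro (_ | x) hx (_ | y) hy hxy
    · rfl
    · simp only [Finset.mem_coe, Finset.some_mem_insertNone, Finset.mem_filter] at hy
      exact absurd hxy.symm hy.2
    · simp only [Finset.mem_coe, Finset.some_mem_insertNone, Finset.mem_filter] at hx
      exact absurd hxy hx.2
    · exact congrArg some (hPinj hxy)
  · rintro (_ | x) hx
    · exact ⟨⟨has, hsσ⟩, hr⟩
    · simp only [Finset.some_mem_insertNone, Finset.mem_filter] at hx
      exact ⟨⟨(hmem x).1 hx.1, hPσ x⟩, hasResidue_gammaFactor_mul_kernel ht k x.1 (x.2 + 1) hx.2⟩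
  · intro z hz hzi
    have hzs : z ≠ s := hzi none (by simp)
    refine AnalyticAt.differentiableAt (AnalyticAt.mul (IsRegular.analyticAt ?_)
      (analyticAt_kernel ht k hzs))
    intro j m hzm
    obtain ⟨q, n, hqn⟩ := exists_pole_eq (lam := lam) j m
    have hzP : z = P ⟨q, n⟩ := hzm.trans hqn
    have hza : z.re ≠ a := fun h => by
      have := ha z.im
      rw [← h, Complex.re_add_im] at this
      exact this j m hzm
    refine hzi (some ⟨q, n⟩) ?_ hzP
    rw [Finset.some_mem_insertNone, Finset.mem_filter, hmem, ← hzP]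
    exact ⟨lt_of_le_of_ne hz.1 hza.symm, hzs⟩
  · refine le_trans ?_ (le_norm_line_sub a y s)
    rw [abs_sub_comm, abs_of_pos (by linarith)]
    exact min_le_left _ _
  · refine le_trans ?_ (le_norm_line_sub σ y s)
    rw [abs_of_pos (by linarith)]
    exact min_le_right _ _
  · refine le_trans ?_ (Complex.abs_im_le_norm _)
    rw [Complex.sub_im]
    have := abs_sub_abs_le_abs_sub z.im s.im
    linarith

theorem tendsto_lineIntegral_zero (hd : 1 ≤ d) {σ : ℝ}
    (hσ : ∀ n : ℕ, IsRegularLine lam (σ - 2 * n)) {t : ℝ} (ht : 0 < t) (s : ℂ) (k : ℕ) :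
    Tendsto (fun M : ℕ => lineIntegral lam (σ - 2 * M) t s k) atTop (𝓝 0) := by
  -- On `Re z = σ - 2M` the factor `t^{-z}` has norm `t^{-σ} t^{2M}`; this rate cancels it and
  -- leaves `2^{-M}`.
  have hr : 0 < (2 * t ^ 2)⁻¹ := by positivity
  obtain ⟨C, hC0, hC⟩ := (integral_norm_gammaFactor_isBigO hd hσ hr).exists_nonneg
  obtain ⟨n₀, hn₀⟩ := exists_nat_ge (σ - s.re + 1)
  have hlim : Tendsto (fun M : ℕ => C * t ^ (-σ) * (1 / 2 : ℝ) ^ M) atTop (𝓝 0) := by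
    simpa using (tendsto_pow_atTop_nhds_zero_of_lt_one (by norm_num)
      (by norm_num : (1 / 2 : ℝ) < 1)).const_mul (C * t ^ (-σ))
  refine squeeze_zero_norm' ?_ hlim
  filter_upwards [hC.bound, eventually_ge_atTop n₀] with M hM hn
  have h1 : (n₀ : ℝ) ≤ M := by exact_mod_cast hn
  have h2 : (0 : ℝ) ≤ n₀ := Nat.cast_nonneg _
  have h3 : (1 : ℝ) ≤ |(σ - 2 * M) - s.re| := by
    rw [abs_sub_comm]
    refine le_trans ?_ (le_abs_self _)
    linarith
  rw [Real.norm_of_nonneg (integral_nonneg fun _ => norm_nonneg _),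
    Real.norm_of_nonneg (by positivity)] at hM
  calc ‖lineIntegral lam (σ - 2 * M) t s k‖
      ≤ ∫ y : ℝ, ‖gammaFactor lam ((σ - 2 * M : ℝ) + y * I)‖ *
          (t ^ (-(σ - 2 * M)) * (1 ^ (k + 1))⁻¹) := by
        refine norm_integral_le_of_norm_le (((hσ M).integrable hd).norm.mul_const _)
          (Eventually.of_forall fun y => ?_)
        rw [norm_mul]
        exact mul_le_mul_of_nonneg_left (norm_kernel_line_le ht k one_pos h3 y) (norm_nonneg _)
    _ = (∫ y : ℝ, ‖gammaFactor lam ((σ - 2 * M : ℝ) + y * I)‖) *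
          (t ^ (-σ) * (t ^ 2) ^ M) := by
        rw [integral_mul_const, one_pow, inv_one, mul_one,
          show -(σ - 2 * (M : ℝ)) = -σ + ((2 * M : ℕ) : ℝ) by push_cast; ring,
          Real.rpow_add ht, Real.rpow_natCast, pow_mul]
    _ ≤ C * (2 * t ^ 2)⁻¹ ^ M * (t ^ (-σ) * (t ^ 2) ^ M) := by gcongr
    _ = C * t ^ (-σ) * (1 / 2 : ℝ) ^ M := by
        have h4 : (1 / 2 : ℝ) ^ M = (2 * t ^ 2)⁻¹ ^ M * (t ^ 2) ^ M := by
          rw [← mul_pow]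
          congr 1
          field_simp
        rw [h4]
        ring

/-- The left side does not depend on how far the contour is moved. Letting `M → ∞` in the finite
residue formula kills the shifted integral and completes the partial sums to `G̃`. -/
theorem factorial_mul_lineIntegral (hd : 1 ≤ d) {σ : ℝ} (hσ : ∀ j, -(lam j).re < σ) {t : ℝ}
    (ht : 0 < t) {s : ℂ} (hs : s.re < σ) (k : ℕ) {r : ℂ}
    (hr : HasResidue (fun z => gammaFactor lam z * kernel t s k z) s (r / (k.factorial : ℂ))) :
    (1 / (2 * Real.pi) : ℝ) * (k.factorial * lineIntegral lam σ t s k) =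
      r - seriesG lam k s t := by
  obtain ⟨σ₀, hσ₀⟩ := exists_isRegularLine lam
  have hk : (k.factorial : ℂ) ≠ 0 := by exact_mod_cast k.factorial_ne_zero
  have hpi : (Real.pi : ℂ) ≠ 0 := by exact_mod_cast Real.pi_ne_zero
  have hN : ∀ q : HodgeClass lam, Tendsto (fun M : ℕ =>
      ⌈((basePoint lam q).re - (σ₀ - 2 * M)) / 2 - 1⌉₊) atTop atTop := fun q => by
    refine tendsto_nat_ceil_atTop.comp ?_
    have : (fun M : ℕ => ((basePoint lam q).re - (σ₀ - 2 * M)) / 2 - 1) =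
        fun M : ℕ => (((basePoint lam q).re - σ₀) / 2 - 1) + (M : ℝ) := by
      ext M; ring
    rw [this]
    exact tendsto_atTop_add_const_left _ _ tendsto_natCast_atTop_atTop
  have hser : Tendsto (fun M : ℕ => ∑ q : HodgeClass lam, (t : ℂ) ^ (-basePoint lam q) *
      ∑ n ∈ Finset.range ⌈((basePoint lam q).re - (σ₀ - 2 * M)) / 2 - 1⌉₊,
        seriesTerm lam q k s t (n + 1)) atTop (𝓝 (seriesG lam k s t)) :=
    tendsto_finsetSum _ fun q _ => (((summable_and_tail_isBigO fun r hr =>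
      seriesTerm_isBigO hd q k s t hr).1.hasSum.tendsto_sum_nat).comp (hN q)).const_mul _
  have hlim := (((tendsto_lineIntegral_zero hd hσ₀ ht s k).const_mul
    ((1 / (2 * Real.pi) : ℝ) * (k.factorial : ℂ))).add_const r).sub hser
  rw [mul_zero, zero_add] at hlim
  refine tendsto_nhds_unique (tendsto_const_nhds.congr' ?_) hlim
  obtain ⟨n₀, hn₀⟩ := exists_nat_ge (σ₀ - s.re + 1)
  filter_upwards [eventually_ge_atTop n₀] with M hM
  have h1 : (n₀ : ℝ) ≤ M := by exact_mod_cast hM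
  have h2 : (0 : ℝ) ≤ n₀ := Nat.cast_nonneg _
  have key := lineIntegral_sub_lineIntegral hd hσ (hσ₀ M) ht (s := s) (by linarith) hs k hr
  rw [sub_eq_iff_eq_add.1 key]
  have h3 : ∀ x : ℂ, ((1 / (2 * Real.pi) : ℝ) : ℂ) * (k.factorial *
      (2 * Real.pi * x + lineIntegral lam (σ₀ - 2 * M) t s k)) =
      (1 / (2 * Real.pi) : ℝ) * (k.factorial : ℂ) * lineIntegral lam (σ₀ - 2 * M) t s k +
        k.factorial * x := fun x => by
    push_cast
    field_simp
    ring
  rw [h3, mul_add, mul_div_cancel₀ _ hk, ← add_assoc, sub_eq_add_neg (_ + r),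
    ← Finset.sum_neg_distrib,
    Finset.mul_sum]
  congr 1
  refine Finset.sum_congr rfl fun q _ => ?_
  rw [Finset.mul_sum, Finset.mul_sum, ← Finset.sum_neg_distrib]
  refine Finset.sum_congr rfl fun n _ => ?_
  rw [mul_div_cancel₀ _ hk]

end

end GammaFactor

theorem mainTheorem3 {d : ℕ} (hd : 1 ≤ d) (lam : Fin d → ℂ)
    (c : ℝ) (hc : ∀ j, -(lam j).re < c) :
    -- `φ` is the inverse Mellin transform of `γ`
    (∀ z : ℂ, (∀ j, -(lam j).re < z.re) →
      MellinConvergent (GammaFactor.phi lam c) z ∧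
        mellin (GammaFactor.phi lam c) z = GammaFactor.gammaFactor lam z) ∧
    ∀ t : ℝ, 0 < t →
      -- `G_s(t)` is given by convergent integrals and is entire in `s`
      (∀ s : ℂ, IntegrableOn
        (fun x : ℝ => GammaFactor.phi lam c x * (x : ℂ) ^ (s - 1)) (Ioi t)) ∧
      Differentiable ℂ (fun s : ℂ => GammaFactor.incompleteMellin lam c s t) ∧
      ∀ (s : ℂ) (k : ℕ),
        -- the series converge, faster than any geometric series
        (∀ q : GammaFactor.HodgeClass lam,
          Summable (fun n : ℕ => GammaFactor.seriesTerm lam q k s t (n + 1)) ∧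
          ∀ r : ℝ, 0 < r →
            (fun M : ℕ => (∑' n : ℕ, GammaFactor.seriesTerm lam q k s t (n + 1)) -
              ∑ n ∈ Finset.range M, GammaFactor.seriesTerm lam q k s t (n + 1))
              =O[atTop] (fun M : ℕ => r ^ M)) ∧
        -- the formula for the derivatives
        ∃ a : ℤ → ℂ,
          GammaFactor.IsLaurentExpansion
            (iteratedDeriv k
              (fun S : ℂ => GammaFactor.gammaFactor lam S * (t : ℂ) ^ (-S))) s a ∧
          iteratedDeriv k (fun S : ℂ => GammaFactor.incompleteMellin lam c S t) s =
            a 0 - GammaFactor.seriesG lam k s t := by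
  refine ⟨fun z hz => GammaFactor.mellin_phi hd hc hz, fun t ht =>
    ⟨GammaFactor.integrableOn_phi_mul_cpow hd hc ht,
      GammaFactor.differentiable_incompleteMellin hd hc ht, fun s k => ⟨fun q =>
        GammaFactor.summable_and_tail_isBigO fun r hr =>
          GammaFactor.seriesTerm_isBigO hd q k s t hr, ?_⟩⟩⟩
  obtain ⟨a, ha, hr⟩ := GammaFactor.exists_isLaurentExpansion_hasResidue lam ht s k
  obtain ⟨σ, h1, h2⟩ : ∃ σ, (∀ k, -(lam k).re < σ) ∧ s.re < σ :=
    ⟨max c (s.re + 1), fun k => (hc k).trans_le (le_max_left _ _),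
      (lt_add_one _).trans_le (le_max_right _ _)⟩
  refine ⟨a, ha, ?_⟩
  rw [GammaFactor.iteratedDeriv_incompleteMellin hd hc h1 ht k h2,
    GammaFactor.factorial_mul_lineIntegral hd h1 ht h2 k hr]
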